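/- A Lorentzian flat Lie algebra is a finite-dimensional real Lie algebra $\mathfrak g$ with a nondegenerate symmetric bilinear form $\langle\,,\rangle$ of signature $(-,+,\dots,+)$ whose Levi-Civita product, defined by $$2\langle u.v,w\rangle=\langle[u,v],w\rangle+\langle[w,u],v\rangle+\langle[w,v],u\rangle ,$$ has zero curvature: $\mathrm L_{[u,v]}=\mathrm L_u\mathrm L_v-\mathrm L_v\mathrm L_u$ for all $u,v\in\mathfrak g$, where $\mathrm L_uv=u.v$. It is nonunimodular if $\mathrm{tr}(\mathrm{ad}_u)\neq0$ for some $u\in\mathfrak g$. An isomorphism between two Lie algebras with such forms is a Lie algebra isomorphism which is an isometry. **Proposition.** Every $4$-dimensional nonunimodular Lorentzian flat Lie algebra $(\mathfrak g,\langle\,,\rangle)$ is isomorphic to one of the following. (i) $\mathfrak g_4=\mathrm{span}\{e,\bar e,e_1,e_2\}$, where the brackets of basis vectors not determined by skew-symmetry from the following ones vanish: $$[\bar e,e]=\mu e,\quad [\bar e,e_1]=\mu e_1+\lambda e_2+\alpha e,\quad [\bar e,e_2]=\beta e,\quad [e_1,e_2]=\lambda e,$$ with $\mu\neq0$ and $\alpha,\beta,\lambda\in\mathbb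 R$. (ii) $\mathfrak g'_4=\mathrm{span}\{e,\bar e,e_1,e_2\}$, where the brackets of basis vectors not determined by skew-symmetry from the following ones vanish: $$[\bar e,e]=\mu e,\quad [\bar e,e_1]=\epsilon\mu e_1+\gamma e_2+\alpha e,\quad [\bar e,e_2]=-\gamma e_1+\epsilon\mu e_2+\beta e,$$ with $\epsilon\in\{0,1\}$, $\mu\neq0$ and $\alpha,\beta,\gamma\in\mathbb R$. In both cases $\{e,\bar e,e_1,e_2\}$ is a basis and the metric is given by $$\langle\,,\rangle_{\{e,\bar e,e_1,e_2\}}=\begin{pmatrix}0&1&0&0\\1&0&0&0\\0&0&1&0\\0&0&0&1\end{pmatrix}.$$ Conversely, all members of both families are nonunimodular Lorentzian flat Lie algebras. Moreover $\dim[\mathfrak g_4,\mathfrak g_4]=2$ and $\dim[\mathfrak g'_4,\mathfrak g'_4]\in\{1,3\}$ for all values of the parameters; hence no member of the first family is isomorphic, as a Lie algebra, to a member of the second. -/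

import Mathlib

noncomputable section

namespace LorentzFlat

section General

variable {𝔤 : Type*} [LieRing 𝔤] [LieAlgebra ℝ 𝔤]

/-- The bilinear map sending `(u, v)` to the linear form
`w ↦ (⟨[u,v],w⟩ + ⟨[w,u],v⟩ + ⟨[w,v],u⟩) / 2` (right-hand side of the Koszul formula). -/
def koszulForm (B : LinearMap.BilinForm ℝ 𝔤) : 𝔤 →ₗ[ℝ] 𝔤 →ₗ[ℝ] Module.Dual ℝ 𝔤 :=
  LinearMap.mk₂ ℝ
    (fun u v =>
      { toFun := fun w => (1 / 2 : ℝ) * (B ⁅u, v⁆ w + B ⁅w, u⁆ v + B ⁅w, v⁆ u)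
        map_add' := fun w w' => by simp only [add_lie, map_add, LinearMap.add_apply]; ring
        map_smul' := fun c w => by
          simp only [smul_lie, map_smul, LinearMap.smul_apply, smul_eq_mul, RingHom.id_apply]
          ring })
    (fun u u' v => by
      ext w
      simp only [add_lie, lie_add, map_add, LinearMap.add_apply, LinearMap.coe_mk, AddHom.coe_mk]
      ring)
    (fun c u v => by
      ext w
      simp only [smul_lie, lie_smul, map_smul, LinearMap.smul_apply, smul_eq_mul,
        LinearMap.coe_mk, AddHom.coe_mk]
      ring)
    (fun u v v' => by
      ext w
      simp only [lie_add, map_add, LinearMap.add_apply, LinearMap.coe_mk, AddHom.coe_mk]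
      ring)
    (fun c u v => by
      ext w
      simp only [lie_smul, map_smul, LinearMap.smul_apply, smul_eq_mul,
        LinearMap.coe_mk, AddHom.coe_mk]
      ring)

/-- The Levi-Civita product: `leviCivita B hB u v = u.v`, so `leviCivita B hB u` is the left
multiplication `L_u`. It is the vector representing `koszulForm B u v` through the metric `B`. -/
def leviCivita [FiniteDimensional ℝ 𝔤] (B : LinearMap.BilinForm ℝ 𝔤) (hB : B.Nondegenerate) :
    𝔤 →ₗ[ℝ] Module.End ℝ 𝔤 :=
  (koszulForm B).compr₂ (B.toDual hB).symm.toLinearMap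

/-- The Koszul formula `2⟨u.v, w⟩ = ⟨[u,v],w⟩ + ⟨[w,u],v⟩ + ⟨[w,v],u⟩`. -/
theorem koszul_formula [FiniteDimensional ℝ 𝔤] (B : LinearMap.BilinForm ℝ 𝔤)
    (hB : B.Nondegenerate) (u v w : 𝔤) :
    2 * B (leviCivita B hB u v) w = B ⁅u, v⁆ w + B ⁅w, u⁆ v + B ⁅w, v⁆ u := by
  have h : B (leviCivita B hB u v) w = koszulForm B u v w := by
    rw [← LinearMap.BilinForm.toDual_def hB]
    simp [leviCivita]
  rw [h]
  simp [koszulForm]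

/-- The curvature `K(u,v) = L_{[u,v]} - [L_u, L_v]`. -/
def curvature [FiniteDimensional ℝ 𝔤] (B : LinearMap.BilinForm ℝ 𝔤) (hB : B.Nondegenerate)
    (u v : 𝔤) : Module.End ℝ 𝔤 :=
  leviCivita B hB ⁅u, v⁆ - ⁅leviCivita B hB u, leviCivita B hB v⁆

/-- `(𝔤, B)` is a Lorentzian flat Lie algebra: `B` is a symmetric nondegenerate bilinear form of
signature `(-, +, …, +)` whose curvature vanishes. -/
structure IsLorentzianFlat [FiniteDimensional ℝ 𝔤] (B : LinearMap.BilinForm ℝ 𝔤) : Prop where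
  symm : B.IsSymm
  nondegenerate : B.Nondegenerate
  signature : sigNeg (LinearMap.BilinMap.toQuadraticMap B) = 1
  flat : ∀ u v : 𝔤, curvature B nondegenerate u v = 0

variable (𝔤) in
/-- `𝔤` is unimodular: `tr (ad_u) = 0` for all `u`. -/
def IsUnimodular : Prop := ∀ u : 𝔤, LinearMap.trace ℝ 𝔤 (LieAlgebra.ad ℝ 𝔤 u) = 0

variable (𝔤) in
/-- The dimension of the derived algebra `[𝔤, 𝔤]`. -/
def derivedDim : ℕ := Module.finrank ℝ (⁅(⊤ : LieIdeal ℝ 𝔤), (⊤ : LieIdeal ℝ 𝔤)⁆ : LieIdeal ℝ 𝔤)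

/-- `(𝔤, B)` and `(𝔥, C)` are isomorphic: there is an isomorphism of Lie algebras which is an
isometry. -/
def MetricIsomorphic {𝔥 : Type*} [LieRing 𝔥] [LieAlgebra ℝ 𝔥]
    (B : LinearMap.BilinForm ℝ 𝔤) (C : LinearMap.BilinForm ℝ 𝔥) : Prop :=
  ∃ φ : 𝔤 ≃ₗ⁅ℝ⁆ 𝔥, ∀ x y : 𝔤, C (φ x) (φ y) = B x y

end General

section Models

/-- In `ℝ⁴` the standard basis is named, in this order, `(e, ē, e₁, e₂)`. -/
abbrev e : Fin 4 → ℝ := Pi.single 0 1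

/-- The second basis vector, `ē`. -/
abbrev ebar : Fin 4 → ℝ := Pi.single 1 1

/-- The third basis vector, `e₁`. -/
abbrev e₁ : Fin 4 → ℝ := Pi.single 2 1

/-- The fourth basis vector, `e₂`. -/
abbrev e₂ : Fin 4 → ℝ := Pi.single 3 1

/-- The metric whose matrix in the basis `(e, ē, e₁, e₂)` is the displayed one. -/
def stdMetric : LinearMap.BilinForm ℝ (Fin 4 → ℝ) :=
  Matrix.toBilin' !![0, 1, 0, 0; 1, 0, 0, 0; 0, 0, 1, 0; 0, 0, 0, 1]

/-- The Lie algebra `𝔤₄`, with underlying vector space `ℝ⁴ = span {e, ē, e₁, e₂}`. -/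
def G4 (_μ _α _β _lam : ℝ) : Type := Fin 4 → ℝ

/-- The Lie algebra `𝔤'₄`, with underlying vector space `ℝ⁴ = span {e, ē, e₁, e₂}`. -/
def G4' (_ε _μ _α _β _γ : ℝ) : Type := Fin 4 → ℝ

namespace G4

variable (μ α β lam : ℝ)

instance : AddCommGroup (G4 μ α β lam) := inferInstanceAs (AddCommGroup (Fin 4 → ℝ))

instance : Module ℝ (G4 μ α β lam) := inferInstanceAs (Module ℝ (Fin 4 → ℝ))

instance : FiniteDimensional ℝ (G4 μ α β lam) :=
  inferInstanceAs (FiniteDimensional ℝ (Fin 4 → ℝ))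

/-- The bilinear alternating extension of `[ē,e] = μe`, `[ē,e₁] = μe₁ + λe₂ + αe`, `[ē,e₂] = βe`,
`[e₁,e₂] = λe`, the other brackets of basis vectors being zero. -/
def bracket (x y : Fin 4 → ℝ) : Fin 4 → ℝ :=
  (x 1 * y 0 - x 0 * y 1) • (μ • e)
    + (x 1 * y 2 - x 2 * y 1) • (μ • e₁ + lam • e₂ + α • e)
    + (x 1 * y 3 - x 3 * y 1) • (β • e)
    + (x 2 * y 3 - x 3 * y 2) • (lam • e)

instance : Bracket (G4 μ α β lam) (G4 μ α β lam) := ⟨bracket μ α β lam⟩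

instance : LieRing (G4 μ α β lam) where
  add_lie x y z := by
    change bracket μ α β lam _ _ = bracket μ α β lam _ _ + bracket μ α β lam _ _
    change Fin 4 → ℝ at x y z
    change bracket μ α β lam (x + y) z = _
    ext i; fin_cases i <;> simp [bracket] <;> ring
  lie_add x y z := by
    change bracket μ α β lam _ _ = bracket μ α β lam _ _ + bracket μ α β lam _ _
    change Fin 4 → ℝ at x y z
    change bracket μ α β lam x (y + z) = _
    ext i; fin_cases i <;> simp [bracket] <;> ring
  lie_self x := by
    change bracket μ α β lam _ _ = (0 : Fin 4 → ℝ)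
    ext i; fin_cases i <;> simp [bracket] <;> ring_nf <;> simp
  leibniz_lie x y z := by
    change bracket μ α β lam _ (bracket μ α β lam _ _) =
      bracket μ α β lam (bracket μ α β lam _ _) _ + bracket μ α β lam _ (bracket μ α β lam _ _)
    ext i; fin_cases i <;> simp [bracket] <;> ring

instance : LieAlgebra ℝ (G4 μ α β lam) where
  lie_smul c x y := by
    change bracket μ α β lam _ _ = c • bracket μ α β lam _ _
    change Fin 4 → ℝ at x y
    change bracket μ α β lam x (c • y) = _
    ext i; fin_cases i <;> simp [bracket] <;> ring

/-- The metric of `𝔤₄`. -/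
def metric : LinearMap.BilinForm ℝ (G4 μ α β lam) := stdMetric

end G4

namespace G4'

variable (ε μ α β γ : ℝ)

instance : AddCommGroup (G4' ε μ α β γ) := inferInstanceAs (AddCommGroup (Fin 4 → ℝ))

instance : Module ℝ (G4' ε μ α β γ) := inferInstanceAs (Module ℝ (Fin 4 → ℝ))

instance : FiniteDimensional ℝ (G4' ε μ α β γ) :=
  inferInstanceAs (FiniteDimensional ℝ (Fin 4 → ℝ))

/-- The bilinear alternating extension of `[ē,e] = μe`, `[ē,e₁] = εμe₁ + γe₂ + αe`,
`[ē,e₂] = -γe₁ + εμe₂ + βe`, the other brackets of basis vectors being zero. -/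
def bracket (x y : Fin 4 → ℝ) : Fin 4 → ℝ :=
  (x 1 * y 0 - x 0 * y 1) • (μ • e)
    + (x 1 * y 2 - x 2 * y 1) • ((ε * μ) • e₁ + γ • e₂ + α • e)
    + (x 1 * y 3 - x 3 * y 1) • (-γ • e₁ + (ε * μ) • e₂ + β • e)

instance : Bracket (G4' ε μ α β γ) (G4' ε μ α β γ) := ⟨bracket ε μ α β γ⟩

instance : LieRing (G4' ε μ α β γ) where
  add_lie x y z := by
    change bracket ε μ α β γ _ _ = bracket ε μ α β γ _ _ + bracket ε μ α β γ _ _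
    change Fin 4 → ℝ at x y z
    change bracket ε μ α β γ (x + y) z = _
    ext i; fin_cases i <;> simp [bracket] <;> ring
  lie_add x y z := by
    change bracket ε μ α β γ _ _ = bracket ε μ α β γ _ _ + bracket ε μ α β γ _ _
    change Fin 4 → ℝ at x y z
    change bracket ε μ α β γ x (y + z) = _
    ext i; fin_cases i <;> simp [bracket] <;> ring
  lie_self x := by
    change bracket ε μ α β γ _ _ = (0 : Fin 4 → ℝ)
    ext i; fin_cases i <;> simp [bracket] <;> ring_nf
  leibniz_lie x y z := by
    change bracket ε μ α β γ _ (bracket ε μ α β γ _ _) =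
      bracket ε μ α β γ (bracket ε μ α β γ _ _) _ + bracket ε μ α β γ _ (bracket ε μ α β γ _ _)
    ext i; fin_cases i <;> simp [bracket] <;> ring

instance : LieAlgebra ℝ (G4' ε μ α β γ) where
  lie_smul c x y := by
    change bracket ε μ α β γ _ _ = c • bracket ε μ α β γ _ _
    change Fin 4 → ℝ at x y
    change bracket ε μ α β γ x (c • y) = _
    ext i; fin_cases i <;> simp [bracket] <;> ring

/-- The metric of `𝔤'₄`. -/
def metric : LinearMap.BilinForm ℝ (G4' ε μ α β γ) := stdMetric

end G4'

end Models

end LorentzFlat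

end

noncomputable section

namespace LorentzFlat

/-! Write `L` and `R` for left and right Levi-Civita multiplication and let `H` be the metric dual
of `u ↦ tr (ad u)`, nonzero by nonunimodularity. Flatness reads `R_{u.v} = R_v R_u + [L_u, R_v]`;
its trace is `⟨u.H, v⟩ = tr (R_v R_u)`, so `R_H` is self-adjoint. Skewness of the `L_u` then gives
`H.H = 0`, so `R_H ^ 2 = [R_H, L_H]`. This makes `R_H` nilpotent
(`isNilpotent_of_sq_eq_commutator`), whence `⟨H, H⟩ = -tr R_H = 0` (`exists_null`).

In dimension 4 the null vector `H` starts a frame `(a, b, p, q)` with the displayed Gram matrix.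
Since `tr R_H ^ 2 = 0` and commutators are orthogonal to `H`, flatness forces `u.a` to be a multiple
of `a` for every `u` (`exists_frame_eigenvector`). The remaining curvature and trace equations give
`L_a = 0` (`eq_zero_of_flat_equations`). What is left is a scalar `c` with `b.a = c a`, a rotation
speed `g`, and a `2 × 2` matrix `K` with `c - tr K = 1` and `g [J, K] = K ^ 2 + c K`, where `J` is a
quarter turn. By `flat_equations_cases`, either `K` is `0` or `-c` times the identity, giving the
second family, or `tr K = -c`, `det K = 0`, `g = 0`; a rotation adapted to the left kernel of `K`
then gives the first.

The converse is a computation with the explicit products, and derived dimensions 2 against 1 or 3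
separate the families. -/

/-- If `A ^ 2 = A * B - B * A` in characteristic zero, then `A` is nilpotent. -/
theorem isNilpotent_of_sq_eq_commutator {K V : Type*} [Field K] [CharZero K] [AddCommGroup V]
    [Module K V] [FiniteDimensional K V] {A B : Module.End K V} (h : A ^ 2 = A * B - B * A) :
    IsNilpotent A := by
  open Polynomial in
  have hpow : ∀ n : ℕ, A ^ n * B - B * A ^ n = (n : K) • A ^ (n + 1) := by
    intro n
    induction n with
    | zero => simp
    | succ n ih =>
      have : A ^ (n + 1) * B - B * A ^ (n + 1)
          = A ^ n * (A * B - B * A) + (A ^ n * B - B * A ^ n) * A := by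
        rw [pow_succ]; noncomm_ring
      rw [this, ih, ← h, ← pow_add, smul_mul_assoc, ← pow_succ]
      push_cast
      rw [add_smul, one_smul, add_comm]
  -- The commutator with `B` acts on polynomials in `A` as the derivation `X ^ 2 d/dX`.
  have hpoly : ∀ p : K[X], aeval A p * B - B * aeval A p = aeval A (X ^ 2 * derivative p) := by
    intro p
    induction p using Polynomial.induction_on' with
    | add p q hp hq =>
      simp only [map_add, mul_add, add_mul] at hp hq ⊢
      rw [← hp, ← hq]; abel
    | monomial n a =>
      have := congrArg (fun T => a • T) (hpow n)
      simp only [smul_sub] at this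
      rw [aeval_monomial, derivative_monomial, map_mul, aeval_monomial]
      simp only [Algebra.algebraMap_eq_smul_one, smul_mul_assoc, one_mul, mul_smul_comm,
        aeval_X_pow]
      rw [this, smul_smul]
      rcases n with _ | n
      · simp
      · congr 1
        rw [← pow_add]; congr 1; simp; omega
  set m := minpoly K A with hm
  have hint : IsIntegral K A := Algebra.IsIntegral.isIntegral A
  have hm0 : m ≠ 0 := minpoly.ne_zero hint
  have hdvd : m ∣ X ^ 2 * derivative m := by
    apply minpoly.dvd
    rw [← hpoly, hm, minpoly.aeval]; simp
  -- Split off the power of `X` in the minimal polynomial. The cofactor `q` is prime to `X`, so `q`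
  -- divides its own derivative, which in characteristic zero makes it constant.
  obtain ⟨q, hq, hnd⟩ := Polynomial.exists_eq_pow_rootMultiplicity_mul_and_not_dvd m hm0 0
  set k := m.rootMultiplicity 0
  rw [C_0, sub_zero] at hq hnd
  have hcop : IsCoprime q X := ((Polynomial.irreducible_X).coprime_iff_not_dvd.2 hnd).symm
  have hq' : q ∣ derivative q := by
    have h1 : q ∣ X ^ 2 * derivative m := dvd_trans ⟨X ^ k, by rw [hq]; ring⟩ hdvd
    rw [hq, derivative_mul] at h1
    have h2 : q ∣ X ^ (2 + k) * derivative q := by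
      have : X ^ (2 + k) * derivative q = X ^ 2 * (derivative (X ^ k) * q + X ^ k * derivative q)
          - q * (X ^ 2 * derivative (X ^ k)) := by ring
      rw [this]
      exact dvd_sub h1 (dvd_mul_right _ _)
    exact (hcop.pow_right).dvd_of_dvd_mul_left h2
  have hdq : derivative q = 0 := by
    by_contra hne
    have hdeg := Polynomial.natDegree_le_of_dvd hq' hne
    have : q.natDegree ≠ 0 := fun h0 => hne (by
      rw [Polynomial.natDegree_eq_zero] at h0; obtain ⟨c, rfl⟩ := h0; simp)
    have := Polynomial.natDegree_derivative_lt this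
    omega
  obtain ⟨c, hc⟩ := Polynomial.natDegree_eq_zero.1 (Polynomial.derivative_eq_zero.1 hdq)
  have hc0 : c ≠ 0 := by
    rintro rfl
    apply hm0; rw [hq, ← hc]; simp
  refine ⟨k, ?_⟩
  have := minpoly.aeval K A
  rw [← hm, hq, ← hc] at this
  simpa [Algebra.algebraMap_eq_smul_one, hc0] using this

/-! ### Consequences of flatness: the null vector dual to the trace of `ad` -/

section LeviCivita

variable {𝔤 : Type*} [LieRing 𝔤] [LieAlgebra ℝ 𝔤] [FiniteDimensional ℝ 𝔤]
  {B : LinearMap.BilinForm ℝ 𝔤}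

/-- Left multiplications of the Levi-Civita product are skew-symmetric. -/
theorem leviCivita_skew (hs : B.IsSymm) (hB : B.Nondegenerate) (u v w : 𝔤) :
    B (leviCivita B hB u v) w = - B v (leviCivita B hB u w) := by
  have h1 := koszul_formula B hB u v w
  have h2 := koszul_formula B hB u w v
  rw [hs.eq v]
  have h3 : B ⁅w, u⁆ v = - B ⁅u, w⁆ v := by rw [← lie_skew, map_neg, LinearMap.neg_apply]
  have h4 : B ⁅w, v⁆ u = - B ⁅v, w⁆ u := by rw [← lie_skew, map_neg, LinearMap.neg_apply]
  have h5 : B ⁅v, u⁆ w = - B ⁅u, v⁆ w := by rw [← lie_skew, map_neg, LinearMap.neg_apply]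
  linarith

/-- The Levi-Civita product is torsion free. -/
theorem leviCivita_sub (hB : B.Nondegenerate) (u v : 𝔤) :
    leviCivita B hB u v - leviCivita B hB v u = ⁅u, v⁆ := by
  refine eq_of_sub_eq_zero (hB.1 _ fun w => ?_)
  have h1 := koszul_formula B hB u v w
  have h2 := koszul_formula B hB v u w
  have h3 : B ⁅v, u⁆ w = - B ⁅u, v⁆ w := by rw [← lie_skew, map_neg, LinearMap.neg_apply]
  simp only [map_sub, LinearMap.sub_apply]
  linarith

/-- A skew-symmetric endomorphism has trace zero. -/
theorem trace_eq_zero_of_skew (hB : B.Nondegenerate) {T : Module.End ℝ 𝔤}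
    (hT : ∀ v w, B (T v) w = - B v (T w)) : LinearMap.trace ℝ 𝔤 T = 0 := by
  -- Transported to the dual by the metric, `-T` becomes the transpose of `T`, so `tr T = -tr T`.
  have h : (B.toDual hB).conj (-T) = Module.Dual.transpose T := by
    ext f v
    obtain ⟨w, rfl⟩ := (B.toDual hB).surjective f
    simp [LinearEquiv.conj_apply, Module.Dual.transpose, LinearMap.BilinForm.toDual_def, hT]
  have h2 := LinearMap.trace_conj' (-T) (B.toDual hB)
  rw [h, LinearMap.trace_transpose', map_neg] at h2
  linarith

/-- The Levi-Civita product of a flat metric is left-symmetric. -/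
theorem IsLorentzianFlat.lie_apply (h : IsLorentzianFlat B) (u v w : 𝔤) :
    leviCivita B h.nondegenerate ⁅u, v⁆ w
      = leviCivita B h.nondegenerate u (leviCivita B h.nondegenerate v w)
        - leviCivita B h.nondegenerate v (leviCivita B h.nondegenerate u w) := by
  have := congrArg (fun T : Module.End ℝ 𝔤 => T w) (h.flat u v)
  simp only [curvature, LinearMap.sub_apply, LinearMap.zero_apply] at this
  rw [sub_eq_zero.1 this]
  rfl

/-- Right multiplication for the Levi-Civita product. -/
def rightMul (B : LinearMap.BilinForm ℝ 𝔤) (hB : B.Nondegenerate) : 𝔤 →ₗ[ℝ] Module.End ℝ 𝔤 :=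
  (leviCivita B hB).flip

theorem rightMul_apply (hB : B.Nondegenerate) (u v : 𝔤) :
    rightMul B hB u v = leviCivita B hB v u := rfl

/-- Torsion-freeness gives `ad u = L_u - R_u`, and the skew map `L_u` has no trace. -/
theorem trace_rightMul (hs : B.IsSymm) (hB : B.Nondegenerate) (u : 𝔤) :
    LinearMap.trace ℝ 𝔤 (rightMul B hB u) = - LinearMap.trace ℝ 𝔤 (LieAlgebra.ad ℝ 𝔤 u) := by
  have h : LieAlgebra.ad ℝ 𝔤 u = leviCivita B hB u - rightMul B hB u := by
    ext v; simp [rightMul_apply, leviCivita_sub]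
  rw [h, map_sub, trace_eq_zero_of_skew hB (leviCivita_skew hs hB u)]
  ring

/-- This is left-symmetry for `u`, `w` acting on `v`, read as an identity of operators in `w`. In
this form traces can be taken, and the commutator drops out. -/
theorem IsLorentzianFlat.rightMul_leviCivita (h : IsLorentzianFlat B) (u v : 𝔤) :
    rightMul B h.nondegenerate (leviCivita B h.nondegenerate u v)
      = rightMul B h.nondegenerate v * rightMul B h.nondegenerate u
        + (leviCivita B h.nondegenerate u * rightMul B h.nondegenerate v
          - rightMul B h.nondegenerate v * leviCivita B h.nondegenerate u) := by
  ext w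
  have h1 := h.lie_apply u w v
  rw [← leviCivita_sub h.nondegenerate, map_sub, LinearMap.sub_apply] at h1
  simp only [rightMul_apply, LinearMap.add_apply, LinearMap.sub_apply, Module.End.mul_apply]
  rw [sub_eq_sub_iff_add_eq_add] at h1
  rw [← sub_eq_zero] at h1 ⊢
  rw [← h1]; abel

/-- A flat nonunimodular Lorentzian Lie algebra has a nonzero null vector `H`, representing
`u ↦ tr (ad u)`, such that right multiplication by `H` is self-adjoint, kills `H` and has a
square of trace zero. -/
theorem IsLorentzianFlat.exists_null (h : IsLorentzianFlat B) (hu : ¬ IsUnimodular 𝔤) :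
    ∃ H : 𝔤, H ≠ 0 ∧ (∀ u, B H u = LinearMap.trace ℝ 𝔤 (LieAlgebra.ad ℝ 𝔤 u)) ∧ B H H = 0 ∧
      leviCivita B h.nondegenerate H H = 0 ∧
      (∀ u v, B (leviCivita B h.nondegenerate u H) v = B (leviCivita B h.nondegenerate v H) u) ∧
      LinearMap.trace ℝ 𝔤 (rightMul B h.nondegenerate H * rightMul B h.nondegenerate H) = 0 := by
  set hB := h.nondegenerate
  let f : Module.Dual ℝ 𝔤 := LinearMap.trace ℝ 𝔤 ∘ₗ (LieAlgebra.ad ℝ 𝔤 : 𝔤 →ₗ[ℝ] Module.End ℝ 𝔤)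
  set H := (B.toDual hB).symm f with hH
  have hHf : ∀ u, B H u = LinearMap.trace ℝ 𝔤 (LieAlgebra.ad ℝ 𝔤 u) := fun u => by
    rw [hH, LinearMap.BilinForm.apply_toDual_symm_apply]; rfl
  -- Take traces in the previous identity and move `L_u` across the metric by skewness; the result
  -- is visibly symmetric in `u` and `v`.
  have htr : ∀ u v, B (leviCivita B hB u H) v
      = LinearMap.trace ℝ 𝔤 (rightMul B hB v * rightMul B hB u) := by
    intro u v
    have h1 := congrArg (LinearMap.trace ℝ 𝔤) (h.rightMul_leviCivita u v)
    rw [trace_rightMul h.symm, ← hHf, map_add, map_sub,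
      LinearMap.trace_mul_comm ℝ (leviCivita B h.nondegenerate u), sub_self, add_zero] at h1
    rw [leviCivita_skew h.symm, h1]
  have hsym : ∀ u v, B (leviCivita B hB u H) v = B (leviCivita B hB v H) u := fun u v => by
    rw [htr, htr, LinearMap.trace_mul_comm]
  have hBs : ∀ x y, B x y = B y x := fun x y => h.symm.eq x y
  have hvH : ∀ v, B (leviCivita B hB v H) H = 0 := fun v => by
    have := leviCivita_skew h.symm hB v H H
    rw [hBs H] at this
    linarith
  -- Symmetry turns `⟨H.H, v⟩` into `⟨v.H, H⟩`, which vanishes by skewness.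
  have hHH : leviCivita B hB H H = 0 := hB.1 _ fun v => by rw [hsym, hvH]
  refine ⟨H, ?_, hHf, ?_, hHH, hsym, ?_⟩
  · intro h0
    exact hu fun u => by rw [← hHf, h0]; simp
  · have hnil : IsNilpotent (rightMul B hB H) := by
      -- As `H.H = 0`, the operator identity at `u = v = H` becomes `R_H ^ 2 = [R_H, L_H]`.
      apply isNilpotent_of_sq_eq_commutator (B := leviCivita B hB H)
      have := h.rightMul_leviCivita H H
      rw [hHH, map_zero] at this
      rw [sq, ← sub_eq_zero, this]
      abel
    have := LinearMap.isNilpotent_trace_of_isNilpotent hnil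
    rw [isNilpotent_iff_eq_zero, trace_rightMul h.symm, ← hHf, neg_eq_zero] at this
    exact this
  · rw [← htr, hHH]; simp

end LeviCivita

/-! ### Frames with two null vectors and two orthonormal ones -/

section Frame

variable {V : Type*} [AddCommGroup V] [Module ℝ V] {B : LinearMap.BilinForm ℝ V}

/-- The Gram matrix of `x 0, x 1, x 2, x 3` is that of `stdMetric`. -/
def IsLorentzFrame (B : LinearMap.BilinForm ℝ V) (x : Fin 4 → V) : Prop :=
  ∀ i j, B (x i) (x j) =
    (!![0, 1, 0, 0; 1, 0, 0, 0; 0, 0, 1, 0; 0, 0, 0, 1] : Matrix (Fin 4) (Fin 4) ℝ) i j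

theorem IsLorentzFrame.of_symm (hs : B.IsSymm) {a b c d : V} (haa : B a a = 0) (hab : B a b = 1)
    (hac : B a c = 0) (had : B a d = 0) (hbb : B b b = 0) (hbc : B b c = 0) (hbd : B b d = 0)
    (hcc : B c c = 1) (hcd : B c d = 0) (hdd : B d d = 1) : IsLorentzFrame B ![a, b, c, d] := by
  have hBs : ∀ x y, B x y = B y x := fun x y => hs.eq x y
  intro i j
  fin_cases i <;> fin_cases j <;> simp [*, hBs b a, hBs c a, hBs d a, hBs c b, hBs d b, hBs d c]

theorem IsLorentzFrame.linearIndependent {x : Fin 4 → V} (hx : IsLorentzFrame B x) :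
    LinearIndependent ℝ x := by
  rw [Fintype.linearIndependent_iff]
  intro g hg0
  have : ∀ j, ∑ i, g i * B (x i) (x j) = 0 := fun j => by
    have := congrArg (fun v => B v (x j)) hg0
    simpa using this
  have h0 := this 0
  have h1 := this 1
  have h2 := this 2
  have h3 := this 3
  simp only [hx _ _, Fin.sum_univ_four] at h0 h1 h2 h3
  simp at h0 h1 h2 h3
  intro i; fin_cases i <;> assumption

/-- The basis given by a frame of a four-dimensional space. -/
def IsLorentzFrame.basis [FiniteDimensional ℝ V] {x : Fin 4 → V} (hx : IsLorentzFrame B x)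
    (hd : Module.finrank ℝ V = 4) : Module.Basis (Fin 4) ℝ V :=
  basisOfLinearIndependentOfCardEqFinrank hx.linearIndependent (by simp [hd])

@[simp]
theorem IsLorentzFrame.coe_basis [FiniteDimensional ℝ V] {x : Fin 4 → V} (hx : IsLorentzFrame B x)
    (hd : Module.finrank ℝ V = 4) : ⇑(hx.basis hd) = x :=
  coe_basisOfLinearIndependentOfCardEqFinrank _ _

variable [FiniteDimensional ℝ V]

/-- The dual frame exchanges `x 0` and `x 1`, hence the crossed coefficients here and in the trace
formula. -/
theorem IsLorentzFrame.eq_sum {x : Fin 4 → V} (hx : IsLorentzFrame B x)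
    (hd : Module.finrank ℝ V = 4) (v : V) :
    v = B v (x 1) • x 0 + B v (x 0) • x 1 + B v (x 2) • x 2 + B v (x 3) • x 3 := by
  obtain ⟨c, rfl⟩ : ∃ c : Fin 4 → ℝ, v = ∑ i, c i • x i :=
    ⟨(hx.basis hd).repr v, by simpa using ((hx.basis hd).sum_repr v).symm⟩
  simp [Fin.sum_univ_four, hx _ _]

theorem IsLorentzFrame.trace {x : Fin 4 → V} (hx : IsLorentzFrame B x)
    (hd : Module.finrank ℝ V = 4) (T : Module.End ℝ V) :
    LinearMap.trace ℝ V T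
      = B (T (x 0)) (x 1) + B (T (x 1)) (x 0) + B (T (x 2)) (x 2) + B (T (x 3)) (x 3) := by
  have h : ∀ v i, (hx.basis hd).repr v i
      = ![B v (x 1), B v (x 0), B v (x 2), B v (x 3)] i := fun v i => by
    conv_lhs => rw [hx.eq_sum hd v]
    have hb : ∀ j, (hx.basis hd).repr (x j) = Finsupp.single j 1 := fun j => by
      rw [← (hx.basis hd).repr_self j, hx.coe_basis]
    simp only [map_add, map_smul, hb]
    fin_cases i <;> simp
  rw [LinearMap.trace_eq_matrix_trace ℝ (hx.basis hd), Matrix.trace, Fin.sum_univ_four]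
  simp [LinearMap.toMatrix_apply, h]

/-- A linear map sending a frame to a frame is an isometry. -/
theorem IsLorentzFrame.exists_isometry {W : Type*} [AddCommGroup W] [Module ℝ W]
    [FiniteDimensional ℝ W] {C : LinearMap.BilinForm ℝ W} {x : Fin 4 → V} {y : Fin 4 → W}
    (hx : IsLorentzFrame B x) (hy : IsLorentzFrame C y) (hd : Module.finrank ℝ V = 4)
    (hd' : Module.finrank ℝ W = 4) :
    ∃ φ : V ≃ₗ[ℝ] W, (∀ i, φ (x i) = y i) ∧ ∀ v w, C (φ v) (φ w) = B v w := by
  have hφ : ∀ i, (hx.basis hd).equiv (hy.basis hd') (Equiv.refl _) (x i) = y i := fun i => by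
    have := (hx.basis hd).equiv_apply i (hy.basis hd') (Equiv.refl _)
    simpa using this
  refine ⟨(hx.basis hd).equiv (hy.basis hd') (Equiv.refl _), hφ, fun v w => ?_⟩
  rw [hx.eq_sum hd v, hx.eq_sum hd w]
  simp only [map_add, map_smul, hφ, LinearMap.add_apply, LinearMap.smul_apply, hx _ _, hy _ _]

/-- A skew-symmetric endomorphism with eigenvector `x 0`, in coordinates. -/
theorem IsLorentzFrame.exists_coords {x : Fin 4 → V} (hx : IsLorentzFrame B x) (hs : B.IsSymm)
    (hd : Module.finrank ℝ V = 4) {T : Module.End ℝ V} (hT : ∀ v w, B (T v) w = - B v (T w))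
    {r : ℝ} (hr : T (x 0) = r • x 0) :
    ∃ t₁ t₂ θ : ℝ, T (x 1) = -r • x 1 + t₁ • x 2 + t₂ • x 3 ∧
      T (x 2) = -t₁ • x 0 + θ • x 3 ∧ T (x 3) = -t₂ • x 0 - θ • x 2 := by
  have hBs : ∀ x y, B x y = B y x := fun x y => hs.eq x y
  have hT' : ∀ v w, B (T v) w = - B (T w) v := fun v w => by rw [hT, hBs]
  have hTs : ∀ v, B (T v) v = 0 := fun v => by linarith [hT' v v]
  have h10 : B (T (x 1)) (x 0) = -r := by rw [hT', hr]; simp [hx _ _]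
  have h20 : B (T (x 2)) (x 0) = 0 := by rw [hT', hr]; simp [hx _ _]
  have h30 : B (T (x 3)) (x 0) = 0 := by rw [hT', hr]; simp [hx _ _]
  refine ⟨B (T (x 1)) (x 2), B (T (x 1)) (x 3), B (T (x 2)) (x 3), ?_, ?_, ?_⟩
  · conv_lhs => rw [hx.eq_sum hd (T (x 1)), hTs, h10]
    simp
  · conv_lhs => rw [hx.eq_sum hd (T (x 2)), hTs, h20, hT' (x 2) (x 1)]
    simp
  · conv_lhs => rw [hx.eq_sum hd (T (x 3)), hTs, h30, hT' (x 3) (x 1), hT' (x 3) (x 2)]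
    simp [sub_eq_add_neg]

/-- A null vector in a four-dimensional Lorentzian space is the first vector of a frame. -/
theorem exists_isLorentzFrame (hs : B.IsSymm) (hB : B.Nondegenerate)
    (hd : Module.finrank ℝ V = 4) (hsig : sigNeg (LinearMap.BilinMap.toQuadraticMap B) = 1)
    {a : V} (ha : a ≠ 0) (haa : B a a = 0) :
    ∃ b c d, IsLorentzFrame B ![a, b, c, d] := by
  have hBs : ∀ x y, B x y = B y x := fun x y => hs.eq x y
  obtain ⟨w, hw⟩ : ∃ w, B a w ≠ 0 := by
    by_contra! hc; exact ha (hB.1 _ hc)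
  obtain ⟨b, hab, hbb⟩ : ∃ b, B a b = 1 ∧ B b b = 0 := by
    -- Scale `w` to pair to 1 with `a`, then subtract the multiple of the null vector `a` that
    -- cancels the square without changing the pairing.
    refine ⟨(B a w)⁻¹ • w - ((B a w)⁻¹ ^ 2 * B w w / 2) • a, ?_, ?_⟩
    · simp [haa, hw]
    · simp [haa, hBs w a]; field_simp; ring
  have hba : B b a = 1 := by rw [hBs, hab]
  let S : Submodule ℝ V := Submodule.span ℝ {a, b}
  let W := B.orthogonal S
  have hW : ∀ x : W, B a x = 0 ∧ B b x = 0 := fun x =>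
    ⟨x.2 a (Submodule.subset_span (by simp)), x.2 b (Submodule.subset_span (by simp))⟩
  have hpair : ∀ y z : V, (∀ s t : ℝ, s • y + t • z = 0 → s = 0 ∧ t = 0) →
      Module.finrank ℝ (Submodule.span ℝ {y, z} : Submodule ℝ V) = 2 := fun y z h => by
    have := finrank_span_eq_card (LinearIndependent.pair_iff.2 h)
    rwa [Matrix.range_cons_cons_empty, Fintype.card_fin] at this
  have hS2 : Module.finrank ℝ S = 2 := hpair a b fun s t h => by
    have h1 := congrArg (B a) h
    have h2 := congrArg (B b) h
    simp [haa, hab, hba, hbb] at h1 h2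
    exact ⟨h2, h1⟩
  have hW2 : Module.finrank ℝ W = 2 := by
    rw [LinearMap.BilinForm.finrank_orthogonal hB, hd, hS2]
  have hdisj : Disjoint S W := by
    rw [Submodule.disjoint_def]
    intro x hxS hxW
    obtain ⟨s, t, rfl⟩ := Submodule.mem_span_pair.1 hxS
    have := hW ⟨_, hxW⟩
    simp [haa, hab, hba, hbb] at this
    simp [this]
  have hWnd : (B.restrict W).Nondegenerate := by
    apply B.nondegenerate_restrict_of_disjoint_orthogonal hs.isRefl
    rw [LinearMap.BilinForm.orthogonal_orthogonal hB hs.isRefl]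
    exact hdisj.symm
  have hWs : LinearMap.IsSymm (B.restrict W) := ⟨fun x y => hs.eq x y⟩
  -- The vector `a - b` has square `-2` and is orthogonal to `W`. A negative `x` in `W` would span
  -- with it a negative definite plane, against index 1.
  have hnn : ∀ x : W, 0 ≤ B x x := by
    intro x
    by_contra! hneg
    obtain ⟨hax, hbx⟩ := hW x
    have hxa : B x a = 0 := by rw [hBs, hax]
    have hxb : B x b = 0 := by rw [hBs, hbx]
    have hq : ∀ s t : ℝ, B (s • (a - b) + t • (x : V)) (s • (a - b) + t • (x : V))
        = - (2 * s ^ 2) + t ^ 2 * B x x := fun s t => by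
      simp [haa, hab, hba, hbb, hax, hbx, hxa, hxb]; ring
    have hst : ∀ s t : ℝ, - (2 * s ^ 2) + t ^ 2 * B x x = 0 → s = 0 ∧ t = 0 := by
      intro s t h
      have h1 : t ^ 2 * B x x ≤ 0 := mul_nonpos_of_nonneg_of_nonpos (sq_nonneg t) hneg.le
      have h2 : s ^ 2 = 0 := by nlinarith [sq_nonneg s]
      have h3 : t ^ 2 * B x x = 0 := by nlinarith
      simpa [hneg.ne] using And.intro h2 h3
    have h2 := hpair (a - b) x fun s t h => hst s t (by rw [← hq, h]; simp)
    have hle := le_sigNeg_of_negDef (LinearMap.BilinMap.toQuadraticMap B)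
      (V := Submodule.span ℝ {a - b, (x : V)}) (by
        rintro ⟨y, hy⟩ hy0
        obtain ⟨s, t, rfl⟩ := Submodule.mem_span_pair.1 hy
        rw [QuadraticMap.restrict_apply]
        simp only [neg_apply, LinearMap.BilinMap.toQuadraticMap_apply, hq]
        have : - (2 * s ^ 2) + t ^ 2 * B x x ≠ 0 := fun h => by
          obtain ⟨rfl, rfl⟩ := hst s t h
          simp at hy0
        have h1 : t ^ 2 * B x x ≤ 0 := mul_nonpos_of_nonneg_of_nonpos (sq_nonneg t) hneg.le
        have h3 : - (2 * s ^ 2) + t ^ 2 * B x x ≤ 0 := by nlinarith [sq_nonneg s]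
        have := lt_of_le_of_ne h3 this
        linarith)
    omega
  obtain ⟨v, hv⟩ := LinearMap.BilinForm.exists_orthogonal_basis hWs
  have hv0 := LinearMap.BilinForm.iIsOrtho.not_isOrtho_basis_self_of_nondegenerate hv hWnd
  have hn : ∀ i, ∃ c : ℝ, B (c • (v i : V)) (c • (v i : V)) = 1 := fun i => by
    have h1 : B (v i) (v i) ≠ 0 := hv0 i
    have h2 := lt_of_le_of_ne (hnn (v i)) h1.symm
    refine ⟨(Real.sqrt (B (v i) (v i)))⁻¹, ?_⟩
    have h3 := Real.sq_sqrt h2.le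
    have h4 := Real.sqrt_pos.2 h2
    simp
    field_simp
    linarith
  let i0 : Fin (Module.finrank ℝ W) := ⟨0, by omega⟩
  let i1 : Fin (Module.finrank ℝ W) := ⟨1, by omega⟩
  have h01 : B (v i0) (v i1) = 0 := hv (by simp [i0, i1])
  obtain ⟨s, hsv⟩ := hn i0
  obtain ⟨t, htv⟩ := hn i1
  refine ⟨b, s • v i0, t • v i1, .of_symm hs haa hab ?_ ?_ hbb ?_ ?_ hsv ?_ htv⟩
  all_goals simp [(hW _).1, (hW _).2, h01]

/-- Sending a frame to a frame is an isomorphism of metric Lie algebras if it is compatible with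
the brackets of vectors of the frames. -/
theorem metricIsomorphic_of_frames {𝔤 𝔥 : Type*} [LieRing 𝔤] [LieAlgebra ℝ 𝔤]
    [FiniteDimensional ℝ 𝔤] [LieRing 𝔥] [LieAlgebra ℝ 𝔥] [FiniteDimensional ℝ 𝔥]
    {B : LinearMap.BilinForm ℝ 𝔤} {C : LinearMap.BilinForm ℝ 𝔥} {x : Fin 4 → 𝔤} {y : Fin 4 → 𝔥}
    (hx : IsLorentzFrame B x) (hy : IsLorentzFrame C y) (hd : Module.finrank ℝ 𝔤 = 4)
    (hd' : Module.finrank ℝ 𝔥 = 4)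
    (h : ∀ φ : 𝔤 →ₗ[ℝ] 𝔥, (∀ i, φ (x i) = y i) → ∀ i j, i < j → φ ⁅x i, x j⁆ = ⁅y i, y j⁆) :
    MetricIsomorphic B C := by
  obtain ⟨φ, hφ, hiso⟩ := hx.exists_isometry hy hd hd'
  have h1 : ∀ i j, φ ⁅x i, x j⁆ = ⁅y i, y j⁆ := fun i j => by
    rcases lt_trichotomy i j with hij | rfl | hij
    · exact h φ hφ i j hij
    · simp
    · rw [← lie_skew, map_neg, ← lie_skew (y i)]
      exact congrArg _ (h φ hφ j i hij)
  have h2 : ∀ u v, φ ⁅u, v⁆ = ⁅φ u, φ v⁆ := fun u v => by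
    rw [hx.eq_sum hd u, hx.eq_sum hd v]
    simp only [map_add, map_smul, add_lie, lie_add, smul_lie, lie_smul, h1, hφ]
  exact ⟨{ φ with map_lie' := fun {u v} => h2 u v }, hiso⟩

end Frame

/-! ### Recognising the product and computing the derived algebra -/

section General

variable {𝔤 : Type*} [LieRing 𝔤] [LieAlgebra ℝ 𝔤]

/-- The Koszul formula determines the product, so an explicit candidate for a model needs only a
polynomial check. -/
theorem leviCivita_eq_of_koszul [FiniteDimensional ℝ 𝔤] {B : LinearMap.BilinForm ℝ 𝔤}
    (hB : B.Nondegenerate) {u v z : 𝔤}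
    (h : ∀ w, 2 * B z w = B ⁅u, v⁆ w + B ⁅w, u⁆ v + B ⁅w, v⁆ u) : leviCivita B hB u v = z := by
  refine eq_of_sub_eq_zero (hB.1 _ fun w => ?_)
  have := koszul_formula B hB u v w
  rw [← h] at this
  rw [map_sub, LinearMap.sub_apply]
  linarith

variable (𝔤) in
/-- The derived algebra is spanned by brackets. -/
theorem derivedDim_eq : derivedDim 𝔤 = Module.finrank ℝ
    (Submodule.span ℝ {z : 𝔤 | ∃ x y : 𝔤, ⁅x, y⁆ = z}) := by
  have h := LieSubmodule.lieIdeal_oper_eq_linear_span' (R := ℝ) (⊤ : LieIdeal ℝ 𝔤)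
    (⊤ : LieIdeal ℝ 𝔤)
  simp only [LieSubmodule.mem_top, true_and] at h
  rw [← h]
  rfl

/-- Each `v i` has to be a single bracket, not merely a combination of brackets; the models satisfy
this. -/
theorem derivedDim_eq_card {ι : Type*} [Fintype ι] {v : ι → 𝔤} (hv : LinearIndependent ℝ v)
    (h1 : ∀ x y : 𝔤, ⁅x, y⁆ ∈ Submodule.span ℝ (Set.range v)) (h2 : ∀ i, ∃ x y : 𝔤, ⁅x, y⁆ = v i) :
    derivedDim 𝔤 = Fintype.card ι := by
  have h : Submodule.span ℝ {z : 𝔤 | ∃ x y : 𝔤, ⁅x, y⁆ = z} = Submodule.span ℝ (Set.range v) := by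
    apply le_antisymm
    · rw [Submodule.span_le]
      rintro _ ⟨x, y, rfl⟩
      exact h1 x y
    · apply Submodule.span_mono
      rintro _ ⟨i, rfl⟩
      exact h2 i
  rw [derivedDim_eq, h, finrank_span_eq_card hv]

theorem derivedDim_congr {𝔥 : Type*} [LieRing 𝔥] [LieAlgebra ℝ 𝔥] (φ : 𝔤 ≃ₗ⁅ℝ⁆ 𝔥) :
    derivedDim 𝔤 = derivedDim 𝔥 := by
  have h : φ.toLinearEquiv '' {z : 𝔤 | ∃ x y : 𝔤, ⁅x, y⁆ = z}
      = {z : 𝔥 | ∃ x y : 𝔥, ⁅x, y⁆ = z} := by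
    ext z
    constructor
    · rintro ⟨_, ⟨x, y, rfl⟩, rfl⟩
      exact ⟨φ x, φ y, (φ.map_lie x y).symm⟩
    · rintro ⟨x, y, rfl⟩
      exact ⟨_, ⟨φ.symm x, φ.symm y, rfl⟩, (φ.map_lie _ _).trans (by simp)⟩
  rw [derivedDim_eq, derivedDim_eq, ← LinearEquiv.finrank_map_eq φ.toLinearEquiv,
    Submodule.map_span, ← h]
  rfl

end General

/-! ### The two families are flat and nonunimodular; their derived dimensions -/

section Models

theorem stdMetric_apply (x y : Fin 4 → ℝ) :
    stdMetric x y = x 1 * y 0 + x 0 * y 1 + x 2 * y 2 + x 3 * y 3 := by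
  simp [stdMetric, Matrix.toBilin'_apply, Fin.sum_univ_four]
  ring

theorem stdMetric_isSymm : stdMetric.IsSymm :=
  ⟨fun x y => by simp only [stdMetric_apply]; ring⟩

theorem stdMetric_nondegenerate : stdMetric.Nondegenerate := by
  rw [stdMetric, LinearMap.BilinForm.nondegenerate_toBilin'_iff_det_ne_zero]
  simp [Matrix.det_succ_row_zero, Fin.sum_univ_succ, Fin.succAbove]

theorem sigNeg_stdMetric : sigNeg (LinearMap.BilinMap.toQuadraticMap stdMetric) = 1 := by
  -- Diagonalise the hyperbolic plane: `2 x₀ x₁ = (x₀ + x₁)² / 2 - (x₀ - x₁)² / 2`. Only the first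
  -- weight is negative.
  let f : (Fin 4 → ℝ) ≃ₗ[ℝ] (Fin 4 → ℝ) :=
    { toFun := fun x => ![x 0 - x 1, x 0 + x 1, x 2, x 3]
      invFun := fun x => ![(x 0 + x 1) / 2, (x 1 - x 0) / 2, x 2, x 3]
      map_add' := fun x y => by ext i; fin_cases i <;> simp <;> ring
      map_smul' := fun c x => by ext i; fin_cases i <;> simp <;> ring
      left_inv := fun x => by ext i; fin_cases i <;> simp
      right_inv := fun x => by ext i; fin_cases i <;> simp <;> ring }
  have hf : ∀ x, QuadraticMap.weightedSumSquares ℝ ![(-1 / 2 : ℝ), 1 / 2, 1, 1] (f x)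
      = LinearMap.BilinMap.toQuadraticMap stdMetric x := fun x => by
    simp [QuadraticMap.weightedSumSquares_apply, Fin.sum_univ_four, stdMetric_apply, f]
    ring
  have h := QuadraticForm.sigNeg_of_equiv_weightedSumSquares
    (Q := LinearMap.BilinMap.toQuadraticMap stdMetric) (w := ![(-1 / 2 : ℝ), 1 / 2, 1, 1])
    ⟨{ toLinearEquiv := f, map_app' := hf }⟩
  rw [h, Set.ncard_eq_one]
  refine ⟨0, ?_⟩
  ext i
  fin_cases i <;> norm_num

theorem isLorentzFrame_stdMetric : IsLorentzFrame stdMetric ![e, ebar, e₁, e₂] := by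
  intro i j
  fin_cases i <;> fin_cases j <;> simp [stdMetric_apply, e, ebar, e₁, e₂]

namespace G4

variable (μ α β lam : ℝ)

/-- The basis `(e, ē, e₁, e₂)` of `𝔤₄`. -/
def frame : Fin 4 → G4 μ α β lam := ![e, ebar, e₁, e₂]

theorem isLorentzFrame : IsLorentzFrame (metric μ α β lam) (frame μ α β lam) :=
  isLorentzFrame_stdMetric

theorem finrank_eq : Module.finrank ℝ (G4 μ α β lam) = 4 :=
  Module.finrank_fin_fun ℝ

theorem lie_frame :
    ⁅frame μ α β lam 0, frame μ α β lam 1⁆ = -μ • frame μ α β lam 0 ∧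
    ⁅frame μ α β lam 0, frame μ α β lam 2⁆ = 0 ∧
    ⁅frame μ α β lam 0, frame μ α β lam 3⁆ = 0 ∧
    ⁅frame μ α β lam 1, frame μ α β lam 2⁆
      = μ • frame μ α β lam 2 + lam • frame μ α β lam 3 + α • frame μ α β lam 0 ∧
    ⁅frame μ α β lam 1, frame μ α β lam 3⁆ = β • frame μ α β lam 0 ∧
    ⁅frame μ α β lam 2, frame μ α β lam 3⁆ = lam • frame μ α β lam 0 := by
  change bracket μ α β lam e ebar = -μ • e ∧ bracket μ α β lam e e₁ = (0 : Fin 4 → ℝ) ∧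
    bracket μ α β lam e e₂ = (0 : Fin 4 → ℝ) ∧
    bracket μ α β lam ebar e₁ = μ • e₁ + lam • e₂ + α • e ∧
    bracket μ α β lam ebar e₂ = β • e ∧ bracket μ α β lam e₁ e₂ = lam • e
  refine ⟨?_, ?_, ?_, ?_, ?_, ?_⟩ <;> simp [bracket, e, ebar, e₁, e₂]

theorem metric_nondegenerate : (metric μ α β lam).Nondegenerate :=
  stdMetric_nondegenerate

/-- The Levi-Civita product of `𝔤₄` in coordinates. -/
def product (u v : Fin 4 → ℝ) : Fin 4 → ℝ :=
  ![u 1 * (μ * v 0 + α * v 2 + β * v 3) + u 2 * (μ * v 2 + lam * v 3), -(μ * u 1 * v 1),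
    -(α * u 1 * v 1) - μ * u 2 * v 1, -(β * u 1 * v 1) - lam * u 2 * v 1]

theorem product_koszul (u v w : Fin 4 → ℝ) :
    2 * stdMetric (product μ α β lam u v) w = stdMetric (bracket μ α β lam u v) w
      + stdMetric (bracket μ α β lam w u) v + stdMetric (bracket μ α β lam w v) u := by
  simp only [stdMetric_apply]
  simp [product, bracket, e, e₁, e₂]
  ring

theorem leviCivita_apply (u v : G4 μ α β lam) :
    leviCivita (metric μ α β lam) (metric_nondegenerate μ α β lam) u v
      = product μ α β lam u v :=
  leviCivita_eq_of_koszul _ (product_koszul μ α β lam u v)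

theorem product_flat (u v w : Fin 4 → ℝ) :
    product μ α β lam (bracket μ α β lam u v) w = product μ α β lam u (product μ α β lam v w)
      - product μ α β lam v (product μ α β lam u w) := by
  ext i
  fin_cases i <;> simp [product, bracket, e, e₁, e₂] <;> ring

theorem isLorentzianFlat : IsLorentzianFlat (metric μ α β lam) where
  symm := stdMetric_isSymm
  nondegenerate := metric_nondegenerate μ α β lam
  signature := sigNeg_stdMetric
  flat u v := by
    refine LinearMap.ext fun w => ?_
    have key : ∀ x y : G4 μ α β lam, leviCivita _ (metric_nondegenerate μ α β lam) x
        (leviCivita _ (metric_nondegenerate μ α β lam) y w)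
        = product μ α β lam x (product μ α β lam y w) := fun x y => by
      rw [leviCivita_apply μ α β lam y w]
      exact leviCivita_apply μ α β lam x _
    change leviCivita _ (metric_nondegenerate μ α β lam) ⁅u, v⁆ w
      - (leviCivita _ (metric_nondegenerate μ α β lam) u
          (leviCivita _ (metric_nondegenerate μ α β lam) v w)
        - leviCivita _ (metric_nondegenerate μ α β lam) v
          (leviCivita _ (metric_nondegenerate μ α β lam) u w)) = 0
    rw [key, key, leviCivita_apply μ α β lam ⁅u, v⁆ w]
    exact sub_eq_zero.2 (product_flat μ α β lam u v w)

variable {μ}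

theorem not_isUnimodular (hμ : μ ≠ 0) : ¬ IsUnimodular (G4 μ α β lam) := by
  intro h
  have h1 := h (frame μ α β lam 1)
  obtain ⟨h01, -, -, h12, h13, -⟩ := lie_frame μ α β lam
  rw [(isLorentzFrame μ α β lam).trace (finrank_eq μ α β lam)] at h1
  simp only [LieAlgebra.ad_apply] at h1
  rw [← lie_skew, h01, lie_self, h12, h13] at h1
  simp [isLorentzFrame μ α β lam _ _] at h1
  -- The trace of `ad ē` is `2μ`.
  exact hμ (by linarith)

theorem derivedDim_eq_two (hμ : μ ≠ 0) : derivedDim (G4 μ α β lam) = 2 := by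
  have hli : LinearIndependent ℝ (![e, μ • e₁ + lam • e₂] : Fin 2 → Fin 4 → ℝ) := by
    rw [LinearIndependent.pair_iff]
    intro s t h
    have h0 := congrFun h 0
    have h2 := congrFun h 2
    simp [e, e₁, e₂, hμ] at h0 h2
    exact ⟨h0, h2⟩
  have hsp : ∀ x y : Fin 4 → ℝ, bracket μ α β lam x y ∈
      Submodule.span ℝ (Set.range (![e, μ • e₁ + lam • e₂] : Fin 2 → Fin 4 → ℝ)) := by
    intro x y
    rw [Submodule.mem_span_range_iff_exists_fun]
    refine ⟨![(x 1 * y 0 - x 0 * y 1) * μ + (x 1 * y 2 - x 2 * y 1) * α + (x 1 * y 3 - x 3 * y 1) * β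
      + (x 2 * y 3 - x 3 * y 2) * lam, x 1 * y 2 - x 2 * y 1], ?_⟩
    ext i
    fin_cases i <;> simp [Fin.sum_univ_succ, bracket, e, e₁, e₂]
  refine (derivedDim_eq_card (𝔤 := G4 μ α β lam) hli hsp fun i => ?_).trans (Fintype.card_fin 2)
  · fin_cases i
    · refine ⟨ebar, (μ⁻¹ • e : Fin 4 → ℝ), ?_⟩
      change bracket μ α β lam ebar (μ⁻¹ • e : Fin 4 → ℝ) = e
      ext i
      fin_cases i <;> simp [bracket, e, ebar, e₁, e₂, hμ]
    -- Since `[ē, e] = μe`, the correction along `e` cancels the term `αe` of `[ē, e₁]`.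
    · refine ⟨ebar, (e₁ - (α / μ) • e : Fin 4 → ℝ), ?_⟩
      change bracket μ α β lam ebar (e₁ - (α / μ) • e : Fin 4 → ℝ) = μ • e₁ + lam • e₂
      ext i
      fin_cases i <;> simp [bracket, e, ebar, e₁, e₂, hμ]

end G4

namespace G4'

variable (ε μ α β γ : ℝ)

/-- The basis `(e, ē, e₁, e₂)` of `𝔤'₄`. -/
def frame : Fin 4 → G4' ε μ α β γ := ![e, ebar, e₁, e₂]

theorem isLorentzFrame : IsLorentzFrame (metric ε μ α β γ) (frame ε μ α β γ) :=
  isLorentzFrame_stdMetric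

theorem finrank_eq : Module.finrank ℝ (G4' ε μ α β γ) = 4 :=
  Module.finrank_fin_fun ℝ

theorem lie_frame :
    ⁅frame ε μ α β γ 0, frame ε μ α β γ 1⁆ = -μ • frame ε μ α β γ 0 ∧
    ⁅frame ε μ α β γ 0, frame ε μ α β γ 2⁆ = 0 ∧
    ⁅frame ε μ α β γ 0, frame ε μ α β γ 3⁆ = 0 ∧
    ⁅frame ε μ α β γ 1, frame ε μ α β γ 2⁆ = (ε * μ) • frame ε μ α β γ 2
      + γ • frame ε μ α β γ 3 + α • frame ε μ α β γ 0 ∧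
    ⁅frame ε μ α β γ 1, frame ε μ α β γ 3⁆ = -γ • frame ε μ α β γ 2
      + (ε * μ) • frame ε μ α β γ 3 + β • frame ε μ α β γ 0 ∧
    ⁅frame ε μ α β γ 2, frame ε μ α β γ 3⁆ = 0 := by
  change bracket ε μ α β γ e ebar = -μ • e ∧ bracket ε μ α β γ e e₁ = (0 : Fin 4 → ℝ) ∧
    bracket ε μ α β γ e e₂ = (0 : Fin 4 → ℝ) ∧
    bracket ε μ α β γ ebar e₁ = (ε * μ) • e₁ + γ • e₂ + α • e ∧
    bracket ε μ α β γ ebar e₂ = -γ • e₁ + (ε * μ) • e₂ + β • e ∧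
    bracket ε μ α β γ e₁ e₂ = (0 : Fin 4 → ℝ)
  refine ⟨?_, ?_, ?_, ?_, ?_, ?_⟩ <;> simp [bracket, e, ebar, e₁, e₂]

theorem metric_nondegenerate : (metric ε μ α β γ).Nondegenerate :=
  stdMetric_nondegenerate

/-- The Levi-Civita product of `𝔤'₄` in coordinates. -/
def product (u v : Fin 4 → ℝ) : Fin 4 → ℝ :=
  ![u 1 * (μ * v 0 + α * v 2 + β * v 3) + ε * μ * (u 2 * v 2 + u 3 * v 3), -(μ * u 1 * v 1),
    -(u 1 * (α * v 1 + γ * v 3)) - ε * μ * u 2 * v 1,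
    -(u 1 * (β * v 1 - γ * v 2)) - ε * μ * u 3 * v 1]

theorem product_koszul (u v w : Fin 4 → ℝ) :
    2 * stdMetric (product ε μ α β γ u v) w = stdMetric (bracket ε μ α β γ u v) w
      + stdMetric (bracket ε μ α β γ w u) v + stdMetric (bracket ε μ α β γ w v) u := by
  simp only [stdMetric_apply]
  simp [product, bracket, e, e₁, e₂]
  ring

theorem leviCivita_apply (u v : G4' ε μ α β γ) :
    leviCivita (metric ε μ α β γ) (metric_nondegenerate ε μ α β γ) u v
      = product ε μ α β γ u v :=
  leviCivita_eq_of_koszul _ (product_koszul ε μ α β γ u v)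

variable {ε}

theorem product_flat (hε : ε = 0 ∨ ε = 1) (u v w : Fin 4 → ℝ) :
    product ε μ α β γ (bracket ε μ α β γ u v) w = product ε μ α β γ u (product ε μ α β γ v w)
      - product ε μ α β γ v (product ε μ α β γ u w) := by
  ext i
  -- Flatness needs `ε ^ 2 = ε`: here `K = -εμ` and `c = μ`, so `K ^ 2 + c K = (ε ^ 2 - ε) μ ^ 2`.
  rcases hε with rfl | rfl <;> fin_cases i <;> simp [product, bracket, e, e₁, e₂] <;> ring

theorem isLorentzianFlat (hε : ε = 0 ∨ ε = 1) : IsLorentzianFlat (metric ε μ α β γ) where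
  symm := stdMetric_isSymm
  nondegenerate := metric_nondegenerate ε μ α β γ
  signature := sigNeg_stdMetric
  flat u v := by
    refine LinearMap.ext fun w => ?_
    have key : ∀ x y : G4' ε μ α β γ, leviCivita _ (metric_nondegenerate ε μ α β γ) x
        (leviCivita _ (metric_nondegenerate ε μ α β γ) y w)
        = product ε μ α β γ x (product ε μ α β γ y w) := fun x y => by
      rw [leviCivita_apply ε μ α β γ y w]
      exact leviCivita_apply ε μ α β γ x _
    change leviCivita _ (metric_nondegenerate ε μ α β γ) ⁅u, v⁆ w
      - (leviCivita _ (metric_nondegenerate ε μ α β γ) u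
          (leviCivita _ (metric_nondegenerate ε μ α β γ) v w)
        - leviCivita _ (metric_nondegenerate ε μ α β γ) v
          (leviCivita _ (metric_nondegenerate ε μ α β γ) u w)) = 0
    rw [key, key, leviCivita_apply ε μ α β γ ⁅u, v⁆ w]
    exact sub_eq_zero.2 (product_flat μ α β γ hε u v w)

variable {μ}

theorem not_isUnimodular (hε : ε = 0 ∨ ε = 1) (hμ : μ ≠ 0) :
    ¬ IsUnimodular (G4' ε μ α β γ) := by
  intro h
  have h1 := h (frame ε μ α β γ 1)
  obtain ⟨h01, -, -, h12, h13, -⟩ := lie_frame ε μ α β γ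
  rw [(isLorentzFrame ε μ α β γ).trace (finrank_eq ε μ α β γ)] at h1
  simp only [LieAlgebra.ad_apply] at h1
  rw [← lie_skew, h01, lie_self, h12, h13] at h1
  simp [isLorentzFrame ε μ α β γ _ _] at h1
  -- The trace of `ad ē` is `(1 + 2ε)μ`, that is `μ` or `3μ`.
  rcases hε with rfl | rfl <;> exact hμ (by linarith)

theorem derivedDim_eq_one (hμ : μ ≠ 0) : derivedDim (G4' 0 μ α β 0) = 1 := by
  have hli : LinearIndependent ℝ (![e] : Fin 1 → Fin 4 → ℝ) := by
    rw [linearIndependent_unique_iff]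
    exact fun h => by simpa [e] using congrFun h 0
  have hsp : ∀ x y : Fin 4 → ℝ, bracket 0 μ α β 0 x y ∈
      Submodule.span ℝ (Set.range (![e] : Fin 1 → Fin 4 → ℝ)) := by
    intro x y
    rw [Submodule.mem_span_range_iff_exists_fun]
    refine ⟨fun _ => (x 1 * y 0 - x 0 * y 1) * μ + (x 1 * y 2 - x 2 * y 1) * α
      + (x 1 * y 3 - x 3 * y 1) * β, ?_⟩
    ext i
    fin_cases i <;> simp [bracket, e, e₁, e₂]
  refine (derivedDim_eq_card (𝔤 := G4' 0 μ α β 0) hli hsp fun i => ?_).trans (Fintype.card_fin 1)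
  · fin_cases i
    refine ⟨ebar, (μ⁻¹ • e : Fin 4 → ℝ), ?_⟩
    change bracket 0 μ α β 0 ebar (μ⁻¹ • e : Fin 4 → ℝ) = e
    ext i
    fin_cases i <;> simp [bracket, e, ebar, e₁, e₂, hμ]

theorem derivedDim_eq_three (hμ : μ ≠ 0) (h : (ε * μ) ^ 2 + γ ^ 2 ≠ 0) :
    derivedDim (G4' ε μ α β γ) = 3 := by
  have hli : LinearIndependent ℝ (![e, e₁, e₂] : Fin 3 → Fin 4 → ℝ) := by
    rw [Fintype.linearIndependent_iff]
    intro g hg i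
    have h0 := congrFun hg 0
    have h2 := congrFun hg 2
    have h3 := congrFun hg 3
    simp [Fin.sum_univ_three, e, e₁, e₂] at h0 h2 h3
    fin_cases i <;> assumption
  have hsp : ∀ x y : Fin 4 → ℝ, bracket ε μ α β γ x y ∈
      Submodule.span ℝ (Set.range (![e, e₁, e₂] : Fin 3 → Fin 4 → ℝ)) := by
    intro x y
    rw [Submodule.mem_span_range_iff_exists_fun]
    refine ⟨![(x 1 * y 0 - x 0 * y 1) * μ + (x 1 * y 2 - x 2 * y 1) * α
      + (x 1 * y 3 - x 3 * y 1) * β,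
      (x 1 * y 2 - x 2 * y 1) * (ε * μ) - (x 1 * y 3 - x 3 * y 1) * γ,
      (x 1 * y 2 - x 2 * y 1) * γ + (x 1 * y 3 - x 3 * y 1) * (ε * μ)], ?_⟩
    ext i
    fin_cases i <;> simp [Fin.sum_univ_succ, bracket, e, e₁, e₂]
    ring
  refine (derivedDim_eq_card (𝔤 := G4' ε μ α β γ) hli hsp fun i => ?_).trans (Fintype.card_fin 3)
  · set D := (ε * μ) ^ 2 + γ ^ 2
    have key : ∀ s t : ℝ, ∃ x y : G4' ε μ α β γ, ⁅x, y⁆ = (s • e₁ + t • e₂ : Fin 4 → ℝ) := by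
      intro s t
      -- Invert the action of `ad ē` on `span {e₁, e₂}` modulo `e`, a scaled rotation of determinant
      -- `D`; the component along `e` is corrected below by dividing by `μ`.
      set s' := (ε * μ * s + γ * t) / D
      set t' := (ε * μ * t - γ * s) / D
      have hs : ε * μ * s' - γ * t' = s := by simp only [s', t']; field_simp; ring
      have ht : γ * s' + ε * μ * t' = t := by simp only [s', t']; field_simp; ring
      refine ⟨ebar, (s' • e₁ + t' • e₂ - ((s' * α + t' * β) / μ) • e : Fin 4 → ℝ), ?_⟩
      change bracket ε μ α β γ ebar
        (s' • e₁ + t' • e₂ - ((s' * α + t' * β) / μ) • e : Fin 4 → ℝ) = _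
      rw [← hs, ← ht]
      ext i
      fin_cases i <;> simp [bracket, e, ebar, e₁, e₂, hμ] <;> ring
    fin_cases i
    · refine ⟨ebar, (μ⁻¹ • e : Fin 4 → ℝ), ?_⟩
      change bracket ε μ α β γ ebar (μ⁻¹ • e : Fin 4 → ℝ) = e
      ext i
      fin_cases i <;> simp [bracket, e, ebar, e₁, e₂, hμ]
    · simpa using key 1 0
    · simpa using key 0 1

theorem derivedDim_eq (hε : ε = 0 ∨ ε = 1) (hμ : μ ≠ 0) :
    derivedDim (G4' ε μ α β γ) = 1 ∨ derivedDim (G4' ε μ α β γ) = 3 := by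
  by_cases h : (ε * μ) ^ 2 + γ ^ 2 = 0
  · left
    obtain rfl : γ = 0 := by nlinarith [sq_nonneg (ε * μ)]
    rcases hε with rfl | rfl
    · exact derivedDim_eq_one α β hμ
    · simp [hμ] at h
  · exact .inr (derivedDim_eq_three α β γ hμ h)

end G4'
end Models

/-! ### Reduction of the flatness equations to a `2 × 2` matrix -/

section Classification

theorem trace_ad_lie {𝔤 : Type*} [LieRing 𝔤] [LieAlgebra ℝ 𝔤] (u v : 𝔤) :
    LinearMap.trace ℝ 𝔤 (LieAlgebra.ad ℝ 𝔤 ⁅u, v⁆) = 0 := by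
  have had : LieAlgebra.ad ℝ 𝔤 ⁅u, v⁆
      = LieAlgebra.ad ℝ 𝔤 u * LieAlgebra.ad ℝ 𝔤 v - LieAlgebra.ad ℝ 𝔤 v * LieAlgebra.ad ℝ 𝔤 u := by
    ext w
    simp only [LinearMap.sub_apply, Module.End.mul_apply, LieAlgebra.ad_apply, lie_lie]
  rw [had, map_sub, LinearMap.trace_mul_comm, sub_self]

variable {𝔤 : Type*} [LieRing 𝔤] [LieAlgebra ℝ 𝔤] [FiniteDimensional ℝ 𝔤]
  {B : LinearMap.BilinForm ℝ 𝔤}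

/-- The image of `R` lies in the orthogonal of `a`, and `R` induces a symmetric map of the Euclidean
plane spanned by `p`, `q` modulo `a`. The trace of `R * R` is the sum of the squared entries of that
map, which must therefore vanish. -/
theorem IsLorentzFrame.selfAdjoint_coords {V : Type*} [AddCommGroup V] [Module ℝ V]
    [FiniteDimensional ℝ V] {B : LinearMap.BilinForm ℝ V} {a b p q : V}
    (hx : IsLorentzFrame B ![a, b, p, q]) (hd : Module.finrank ℝ V = 4) {R : Module.End ℝ V}
    (hsym : ∀ u v, B (R u) v = B (R v) u) (ha : R a = 0)
    (hsq : LinearMap.trace ℝ V (R * R) = 0) :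
    ∃ c α β : ℝ, R b = c • a + α • p + β • q ∧ R p = α • a ∧ R q = β • a := by
  have hsum : ∀ v, v = B v b • a + B v a • b + B v p • p + B v q • q := hx.eq_sum hd
  have hva : ∀ v, B (R v) a = 0 := fun v => by rw [hsym, ha]; simp
  have hpa := hsum (R p)
  have hqa := hsum (R q)
  have hba := hsum (R b)
  rw [hva, zero_smul, add_zero] at hpa hqa hba
  rw [hsym b p, hsym b q] at hba
  rw [hsym p q] at hpa
  have htrace := hx.trace hd (R * R)
  rw [hsq] at htrace
  change 0 = B (R (R a)) b + B (R (R b)) a + B (R (R p)) p + B (R (R q)) q at htrace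
  have hpp : B (R (R p)) p = B (R p) p ^ 2 + B (R q) p ^ 2 := by
    conv_lhs => rw [hpa]
    simp [ha]; ring
  have hqq : B (R (R q)) q = B (R q) q ^ 2 + B (R q) p ^ 2 := by
    conv_lhs => rw [hqa]
    simp [ha, hsym p q]; ring
  rw [ha, hva, hpp, hqq, map_zero, map_zero, LinearMap.zero_apply] at htrace
  have h1 : B (R p) p = 0 := by
    apply pow_eq_zero_iff (two_ne_zero) |>.1
    nlinarith [sq_nonneg (B (R p) p), sq_nonneg (B (R q) p), sq_nonneg (B (R q) q)]
  have h2 : B (R q) p = 0 := by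
    apply pow_eq_zero_iff (two_ne_zero) |>.1
    nlinarith [sq_nonneg (B (R p) p), sq_nonneg (B (R q) p), sq_nonneg (B (R q) q)]
  have h3 : B (R q) q = 0 := by
    apply pow_eq_zero_iff (two_ne_zero) |>.1
    nlinarith [sq_nonneg (B (R p) p), sq_nonneg (B (R q) p), sq_nonneg (B (R q) q)]
  rw [h1, h2, zero_smul, zero_smul, add_zero, add_zero] at hpa
  rw [h3, h2, zero_smul, zero_smul, add_zero, add_zero] at hqa
  exact ⟨_, _, _, hba, hpa, hqa⟩

/-- The null vector dual to `u ↦ tr (ad u)` extends to a frame and is a common eigenvector of the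
left multiplications, all of which but one kill it. -/
theorem IsLorentzianFlat.exists_frame_eigenvector (h : IsLorentzianFlat B)
    (hd : Module.finrank ℝ 𝔤 = 4) (hu : ¬ IsUnimodular 𝔤) :
    ∃ (x : Fin 4 → 𝔤) (r : ℝ), IsLorentzFrame B x ∧
      (∀ u, B (x 0) u = LinearMap.trace ℝ 𝔤 (LieAlgebra.ad ℝ 𝔤 u)) ∧
      leviCivita B h.nondegenerate (x 0) (x 0) = 0 ∧
      leviCivita B h.nondegenerate (x 1) (x 0) = r • x 0 ∧
      leviCivita B h.nondegenerate (x 2) (x 0) = 0 ∧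
      leviCivita B h.nondegenerate (x 3) (x 0) = 0 := by
  obtain ⟨a, ha, htr, haa, hLa, hsym, hsq⟩ := h.exists_null hu
  obtain ⟨b, p, q, hx⟩ := exists_isLorentzFrame h.symm h.nondegenerate hd h.signature ha haa
  set L := leviCivita B h.nondegenerate with hL
  have hBs : ∀ x y, B x y = B y x := fun x y => h.symm.eq x y
  have hsk : ∀ u v w, B (L u v) w = - B (L u w) v := fun u v w => by
    rw [hL, leviCivita_skew h.symm, hBs]
  have hvv : ∀ u v, B (L u v) v = 0 := fun u v => by linarith [hsk u v v]
  have hsum : ∀ v, v = B v b • a + B v a • b + B v p • p + B v q • q := hx.eq_sum hd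
  obtain ⟨c, α, β, hba, hpa, hqa⟩ := hx.selfAdjoint_coords hd
    (R := rightMul B h.nondegenerate a) hsym hLa hsq
  simp only [rightMul_apply, ← hL] at hba hpa hqa
  have hap : B a p = 0 := hx 0 2
  have haq : B a q = 0 := hx 0 3
  have hpp : B p p = 1 := hx 2 2
  have hqq : B q q = 1 := hx 3 3
  have hpq : B p q = 0 := hx 2 3
  have hqp : B q p = 0 := hx 3 2
  -- Commutators have `ad` of trace zero, so they are orthogonal to `a` and have no component along
  -- `b`, the only frame vector whose product with `a` may leave the line of `a`.
  have hder : ∀ u v : 𝔤, ∃ r : ℝ, L ⁅u, v⁆ a = r • a := fun u v => by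
    have h0 : B ⁅u, v⁆ a = 0 := by
      rw [hBs, htr, trace_ad_lie]
    refine ⟨B ⁅u, v⁆ p * α + B ⁅u, v⁆ q * β, ?_⟩
    conv_lhs => rw [hsum ⁅u, v⁆]
    simp [hLa, h0, hpa, hqa, add_smul, mul_smul]
  -- Apply flatness for `u`, `b` to `a` and pair with `y` orthogonal to `a`: every multiple of `a`
  -- disappears, including the terms in `c`.
  have key : ∀ u s, L u a = s • a → ∀ y, B a y = 0 →
      α * B (L u p) y + β * B (L u q) y = s * (α * B p y + β * B q y) := by
    intro u s hs y hy
    obtain ⟨r, hr⟩ := hder u b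
    rw [hL, h.lie_apply, ← hL, hba, hs] at hr
    have := congrArg (fun v => B v y) hr
    simp [hs, hy, hba] at this
    linarith
  have e1 := key p α hpa p hap
  have e2 := key p α hpa q haq
  have e3 := key q β hqa q haq
  rw [hvv, hpp, hqp] at e1
  rw [hvv, hpq, hqq, hsk p p q] at e2
  rw [hvv, hpq, hqq] at e3
  have hα : α = 0 := by
    have : α * (α ^ 2 + β ^ 2) = 0 := by linear_combination (-α) * e1 - β * e2
    rcases mul_eq_zero.1 this with h | h
    · exact h
    · nlinarith [sq_nonneg β]
  have hβ : β = 0 := by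
    rw [hα] at e3
    nlinarith
  rw [hα, zero_smul] at hpa
  rw [hβ, zero_smul] at hqa
  rw [hα, hβ, zero_smul, zero_smul, add_zero, add_zero] at hba
  exact ⟨_, c, hx, htr, hLa, hba, hpa, hqa⟩

/-- The curvature and trace equations of a frame whose first vector is an eigenvector of the left
multiplications force the remaining left multiplications to be determined by a rotation and a
`2 × 2` matrix. -/
theorem eq_zero_of_flat_equations {b₁ b₂ c d k₁₁ k₁₂ k₂₁ k₂₂ h₁ h₂ f₁ f₂ g : ℝ}
    (tb : 1 = c + -k₁₁ + -k₂₂) (tp : b₁ = h₂) (tq : h₁ = -b₂)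
    (abo : b₁ * h₁ + b₂ * h₂ - c * d = 0)
    (app : -b₁ * b₁ + d * k₂₁ = k₁₂ * -d - b₂ * -h₁)
    (apq : -b₁ * b₂ + d * k₂₂ = k₁₁ * d - b₁ * h₁)
    (bpp : -f₁ * b₁ + g * k₂₁ - (k₁₁ * k₁₁ + k₁₂ * k₂₁) = k₁₂ * -g - (-c * k₁₁ + f₂ * -h₁))
    (bqq : -f₂ * b₂ - g * k₁₂ - (k₂₁ * k₁₂ + k₂₂ * k₂₂) = k₂₁ * g - (-c * k₂₂ + f₁ * h₂))
    (pqo : -k₁₂ * d - h₁ * h₁ - (-k₂₁ * d + h₂ * h₂) = 0) : b₁ = 0 ∧ b₂ = 0 ∧ d = 0 := by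
  subst tp tq
  have hcd : c * d = 0 := by linarith
  -- If `d ≠ 0` then `c = 0` and `tr K ^ 2 = 0`. The next three equations express the entries of `d
  -- K` other than its trace through `b₁`, `b₂`, and their squares cancel in `(tr K)²`. So `tr K =
  -- 0`, contradicting `c - tr K = 1`.
  have hd : d = 0 := by
    by_contra hd
    obtain rfl : c = 0 := by simpa [hd] using hcd
    have htr : k₁₁ * k₁₁ + 2 * (k₁₂ * k₂₁) + k₂₂ * k₂₂ = 0 := by linear_combination -bpp - bqq
    have h1 : d * (k₂₂ - k₁₁) = 2 * (b₁ * b₂) := by linear_combination apq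
    have h2 : d * (k₂₁ + k₁₂) = b₁ ^ 2 - b₂ ^ 2 := by linear_combination app
    have h3 : d * (k₂₁ - k₁₂) = b₁ ^ 2 + b₂ ^ 2 := by linear_combination pqo
    have h4 : d ^ 2 * (k₁₁ + k₂₂) ^ 2 = 0 := by
      linear_combination 2 * d ^ 2 * htr - (d * (k₂₂ - k₁₁) + 2 * (b₁ * b₂)) * h1
        - (d * (k₂₁ + k₁₂) + (b₁ ^ 2 - b₂ ^ 2)) * h2 + (d * (k₂₁ - k₁₂) + (b₁ ^ 2 + b₂ ^ 2)) * h3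
    have h5 : k₁₁ + k₂₂ = 0 := by simpa [hd] using h4
    linarith
  subst hd
  have h3 : b₁ ^ 2 + b₂ ^ 2 = 0 := by linear_combination -pqo
  refine ⟨?_, ?_, rfl⟩ <;> nlinarith [sq_nonneg b₁, sq_nonneg b₂]

/-- The brackets of a four-dimensional nonunimodular Lorentzian flat Lie algebra in a suitable
frame. -/
theorem IsLorentzianFlat.exists_frame_lie (h : IsLorentzianFlat B)
    (hd : Module.finrank ℝ 𝔤 = 4) (hu : ¬ IsUnimodular 𝔤) :
    ∃ (a b p q : 𝔤) (c f₁ f₂ g k₁₁ k₁₂ k₂₁ k₂₂ : ℝ), IsLorentzFrame B ![a, b, p, q] ∧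
      c - k₁₁ - k₂₂ = 1 ∧
      g * (k₁₂ + k₂₁) = k₁₁ * k₁₁ + k₁₂ * k₂₁ + c * k₁₁ ∧
      g * (k₂₂ - k₁₁) = k₁₁ * k₁₂ + k₁₂ * k₂₂ + c * k₁₂ ∧
      g * (k₂₂ - k₁₁) = k₂₁ * k₁₁ + k₂₂ * k₂₁ + c * k₂₁ ∧
      -(g * (k₁₂ + k₂₁)) = k₂₁ * k₁₂ + k₂₂ * k₂₂ + c * k₂₂ ∧
      ⁅a, b⁆ = -c • a ∧ ⁅a, p⁆ = 0 ∧ ⁅a, q⁆ = 0 ∧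
      ⁅b, p⁆ = -f₁ • a - k₁₁ • p + (g - k₁₂) • q ∧
      ⁅b, q⁆ = -f₂ • a - (g + k₂₁) • p - k₂₂ • q ∧
      ⁅p, q⁆ = (k₂₁ - k₁₂) • a := by
  obtain ⟨x, c, hx, htr, h00, h10, h20, h30⟩ := h.exists_frame_eigenvector hd hu
  set L := leviCivita B h.nondegenerate with hL
  obtain ⟨a, b, p, q, rfl⟩ : ∃ a b p q, x = ![a, b, p, q] :=
    ⟨x 0, x 1, x 2, x 3, by ext i; fin_cases i <;> rfl⟩
  have hsk : ∀ u v w, B (L u v) w = - B v (L u w) := leviCivita_skew h.symm h.nondegenerate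
  -- The rotation parts of `L_a`, `L_b`, `L_p`, `L_q` are `d`, `g`, `h₁`, `h₂`. The rows of `K` are
  -- the `p`, `q` coordinates of `p.b` and `q.b`.
  obtain ⟨b₁, b₂, d, h01, h02, h03⟩ :=
    hx.exists_coords h.symm hd (hsk _) (r := 0) (by simpa using h00)
  obtain ⟨f₁, f₂, g, h11, h12, h13⟩ := hx.exists_coords h.symm hd (hsk _) h10
  obtain ⟨k₁₁, k₁₂, h₁, h21, h22, h23⟩ :=
    hx.exists_coords h.symm hd (hsk _) (r := 0) (by simpa using h20)
  obtain ⟨k₂₁, k₂₂, h₂, h31, h32, h33⟩ :=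
    hx.exists_coords h.symm hd (hsk _) (r := 0) (by simpa using h30)
  clear hsk
  simp only [Matrix.cons_val, neg_zero, zero_smul, zero_add] at htr h00 h10 h20 h30 h01 h02 h03
  simp only [Matrix.cons_val, neg_zero, zero_smul, zero_add] at h11 h12 h13 h21 h22 h23 h31 h32 h33
  -- Components of the curvature, with the bracket written through the product so that the
  -- coordinate formulas apply; `T` does the same for `tr (ad u) = ⟨a, u⟩`.
  have E : ∀ u v w y, B (L (L u v - L v u) w) y = B (L u (L v w) - L v (L u w)) y :=
    fun u v w y => by rw [leviCivita_sub, h.lie_apply]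
  have T : ∀ u, B a u = B (L u a - L a u) b + B (L u b - L b u) a + B (L u p - L p u) p
      + B (L u q - L q u) q := fun u => by
    rw [htr, hx.trace hd]
    simp only [LieAlgebra.ad_apply, leviCivita_sub, hL]
    rfl
  have tb := T b
  have tp := T p
  have tq := T q
  have abo := E a b p q
  have app := E a p b p
  have apq := E a p b q
  have bpp := E b p b p
  have bpq := E b p b q
  have bqp := E b q b p
  have bqq := E b q b q
  have pqo := E p q p q
  have hab : B a b = 1 := hx 0 1
  have hap : B a p = 0 := hx 0 2
  have haq : B a q = 0 := hx 0 3
  have haa : B a a = 0 := hx 0 0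
  have hpa : B p a = 0 := hx 2 0
  have hpb : B p b = 0 := hx 2 1
  have hpp : B p p = 1 := hx 2 2
  have hpq : B p q = 0 := hx 2 3
  have hqa : B q a = 0 := hx 3 0
  have hqb : B q b = 0 := hx 3 1
  have hqp : B q p = 0 := hx 3 2
  have hqq : B q q = 1 := hx 3 3
  simp only [h00, h01, h02, h03, h10, h11, h12, h13, h20, h21, h22, h23, h30, h31, h32, h33,
    map_add, map_sub, map_smul, map_neg, map_zero, LinearMap.add_apply, LinearMap.sub_apply,
    LinearMap.smul_apply, LinearMap.neg_apply, LinearMap.zero_apply, smul_eq_mul, haa, hab,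
    hap, haq, hpa, hpb, hpp, hpq, hqa, hqb, hqp, hqq, mul_zero, mul_one, add_zero,
    zero_add, sub_zero, zero_sub, sub_self] at tb tp tq abo app apq bpp bpq bqp bqq pqo
  obtain ⟨rfl, rfl, rfl⟩ := eq_zero_of_flat_equations tb (by linarith) (by linarith) abo app apq
    bpp bqq pqo
  obtain rfl : h₁ = 0 := by linarith
  obtain rfl : h₂ = 0 := by linarith
  refine ⟨a, b, p, q, c, f₁, f₂, g, k₁₁, k₁₂, k₂₁, k₂₂, hx, by linarith, by linarith, by linarith,
    by linarith, by linarith, ?_, ?_, ?_, ?_, ?_, ?_⟩ <;>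
  simp only [← leviCivita_sub h.nondegenerate, ← hL, h01, h02, h03, h10, h12, h13, h20,
    h21, h23, h30, h31, h32] <;>
  module

end Classification

/-! ### Normal forms: solving the matrix equation and rotating the frame -/

section Classification

variable {𝔤 : Type*} [LieRing 𝔤] [LieAlgebra ℝ 𝔤]
  {B : LinearMap.BilinForm ℝ 𝔤} {a b p q : 𝔤}

/-- A rotation of the last two vectors of a frame gives a frame. -/
theorem IsLorentzFrame.rotate (hs : B.IsSymm) (hx : IsLorentzFrame B ![a, b, p, q]) {s t : ℝ}
    (hst : s ^ 2 + t ^ 2 = 1) : IsLorentzFrame B ![a, b, t • p - s • q, s • p + t • q] := by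
  have hap : B a p = 0 := hx 0 2
  have haq : B a q = 0 := hx 0 3
  have hbp : B b p = 0 := hx 1 2
  have hbq : B b q = 0 := hx 1 3
  have hpp : B p p = 1 := hx 2 2
  have hpq : B p q = 0 := hx 2 3
  have hqp : B q p = 0 := hx 3 2
  have hqq : B q q = 1 := hx 3 3
  refine .of_symm hs (hx 0 0) (hx 0 1) ?_ ?_ (hx 1 1) ?_ ?_ ?_ ?_ ?_ <;>
    simp only [map_add, map_sub, map_smul, LinearMap.add_apply, LinearMap.sub_apply,
      LinearMap.smul_apply, smul_eq_mul, hap, haq, hbp, hbq, hpp, hpq, hqp, hqq] <;>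
    linarith

variable [FiniteDimensional ℝ 𝔤]

theorem metricIsomorphic_G4 {μ α β lam : ℝ} (hx : IsLorentzFrame B ![a, b, p, q])
    (hd : Module.finrank ℝ 𝔤 = 4) (hab : ⁅a, b⁆ = -μ • a) (hap : ⁅a, p⁆ = 0) (haq : ⁅a, q⁆ = 0)
    (hbp : ⁅b, p⁆ = μ • p + lam • q + α • a) (hbq : ⁅b, q⁆ = β • a) (hpq : ⁅p, q⁆ = lam • a) :
    MetricIsomorphic B (G4.metric μ α β lam) := by
  refine metricIsomorphic_of_frames hx (G4.isLorentzFrame μ α β lam) hd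
    (G4.finrank_eq μ α β lam) fun φ hφ i j hij => ?_
  obtain ⟨h01, h02, h03, h12, h13, h23⟩ := G4.lie_frame μ α β lam
  have h0 : φ a = _ := hφ 0
  have h2 : φ p = _ := hφ 2
  have h3 : φ q = _ := hφ 3
  fin_cases i <;> fin_cases j <;> first | exact absurd hij (by decide) | skip
  · exact (congrArg φ hab).trans (by rw [map_smul, h0]; exact h01.symm)
  · exact (congrArg φ hap).trans (by rw [map_zero]; exact h02.symm)
  · exact (congrArg φ haq).trans (by rw [map_zero]; exact h03.symm)
  · exact (congrArg φ hbp).trans (by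
      rw [map_add, map_add, map_smul, map_smul, map_smul, h0, h2, h3]; exact h12.symm)
  · exact (congrArg φ hbq).trans (by rw [map_smul, h0]; exact h13.symm)
  · exact (congrArg φ hpq).trans (by rw [map_smul, h0]; exact h23.symm)

theorem metricIsomorphic_G4' {ε μ α β γ : ℝ} (hx : IsLorentzFrame B ![a, b, p, q])
    (hd : Module.finrank ℝ 𝔤 = 4) (hab : ⁅a, b⁆ = -μ • a) (hap : ⁅a, p⁆ = 0) (haq : ⁅a, q⁆ = 0)
    (hbp : ⁅b, p⁆ = (ε * μ) • p + γ • q + α • a) (hbq : ⁅b, q⁆ = -γ • p + (ε * μ) • q + β • a)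
    (hpq : ⁅p, q⁆ = 0) : MetricIsomorphic B (G4'.metric ε μ α β γ) := by
  refine metricIsomorphic_of_frames hx (G4'.isLorentzFrame ε μ α β γ) hd
    (G4'.finrank_eq ε μ α β γ) fun φ hφ i j hij => ?_
  obtain ⟨h01, h02, h03, h12, h13, h23⟩ := G4'.lie_frame ε μ α β γ
  have h0 : φ a = _ := hφ 0
  have h2 : φ p = _ := hφ 2
  have h3 : φ q = _ := hφ 3
  fin_cases i <;> fin_cases j <;> first | exact absurd hij (by decide) | skip
  · exact (congrArg φ hab).trans (by rw [map_smul, h0]; exact h01.symm)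
  · exact (congrArg φ hap).trans (by rw [map_zero]; exact h02.symm)
  · exact (congrArg φ haq).trans (by rw [map_zero]; exact h03.symm)
  · exact (congrArg φ hbp).trans (by
      rw [map_add, map_add, map_smul, map_smul, map_smul, h0, h2, h3]; exact h12.symm)
  · exact (congrArg φ hbq).trans (by
      rw [map_add, map_add, map_smul, map_smul, map_smul, h0, h2, h3]; exact h13.symm)
  · exact (congrArg φ hpq).trans (by rw [map_zero]; exact h23.symm)

/-- A singular `2 × 2` matrix has a unit vector in its (left) kernel. -/
theorem exists_unit_kernel {k₁₁ k₁₂ k₂₁ k₂₂ : ℝ} (h : k₁₁ * k₂₂ = k₁₂ * k₂₁) :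
    ∃ s t : ℝ, s ^ 2 + t ^ 2 = 1 ∧ s * k₁₁ + t * k₂₁ = 0 ∧ s * k₁₂ + t * k₂₂ = 0 := by
  have key : ∀ x y : ℝ, (x ≠ 0 ∨ y ≠ 0) → x * k₁₁ + y * k₂₁ = 0 → x * k₁₂ + y * k₂₂ = 0 →
      ∃ s t : ℝ, s ^ 2 + t ^ 2 = 1 ∧ s * k₁₁ + t * k₂₁ = 0 ∧ s * k₁₂ + t * k₂₂ = 0 := by
    intro x y hxy h1 h2
    have hpos : 0 < x ^ 2 + y ^ 2 := by
      rcases hxy with hx | hy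
      · have := sq_pos_of_ne_zero hx; positivity
      · have := sq_pos_of_ne_zero hy; positivity
    have hr := Real.sqrt_pos.2 hpos
    have hr2 := Real.sq_sqrt hpos.le
    refine ⟨x / Real.sqrt (x ^ 2 + y ^ 2), y / Real.sqrt (x ^ 2 + y ^ 2), ?_, ?_, ?_⟩
    · rw [div_pow, div_pow, hr2, ← add_div, div_self hpos.ne']
    · rw [div_mul_eq_mul_div, div_mul_eq_mul_div, ← add_div, h1, zero_div]
    · rw [div_mul_eq_mul_div, div_mul_eq_mul_div, ← add_div, h2, zero_div]
  -- The candidates are the rows of the adjugate up to sign; if both vanish then so does `K`, and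
  -- any unit vector works.
  by_cases h1 : k₂₁ ≠ 0 ∨ -k₁₁ ≠ 0
  · exact key k₂₁ (-k₁₁) h1 (by ring) (by linarith)
  by_cases h2 : k₂₂ ≠ 0 ∨ -k₁₂ ≠ 0
  · exact key k₂₂ (-k₁₂) h2 (by linarith) (by ring)
  simp only [not_or, not_not, neg_eq_zero] at h1 h2
  exact key 1 0 (by simp) (by simp [h1]) (by simp [h2])

/-- Solutions of the flatness equations. -/
theorem flat_equations_cases {c g k₁₁ k₁₂ k₂₁ k₂₂ : ℝ} (h0 : c - k₁₁ - k₂₂ = 1)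
    (h1 : g * (k₁₂ + k₂₁) = k₁₁ * k₁₁ + k₁₂ * k₂₁ + c * k₁₁)
    (h2 : g * (k₂₂ - k₁₁) = k₁₁ * k₁₂ + k₁₂ * k₂₂ + c * k₁₂)
    (h3 : g * (k₂₂ - k₁₁) = k₂₁ * k₁₁ + k₂₂ * k₂₁ + c * k₂₁)
    (h4 : -(g * (k₁₂ + k₂₁)) = k₂₁ * k₁₂ + k₂₂ * k₂₂ + c * k₂₂) :
    c ≠ 0 ∧ ((k₁₂ = 0 ∧ k₂₁ = 0 ∧ k₁₁ = k₂₂ ∧ (k₂₂ = 0 ∨ k₂₂ = -c)) ∨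
      (k₁₁ + k₂₂ = -c ∧ g = 0 ∧ k₁₁ * k₂₂ = k₁₂ * k₂₁)) := by
  -- By Cayley–Hamilton `K ^ 2 + c K = (tr K + c) K - det K`. When `tr K = -c` the right side is
  -- scalar while the commutator is traceless, so `det K = 0`. If moreover `g ≠ 0`, then `K`
  -- commutes with `J`, so `K = -1/4 + k₁₂ J` has positive determinant, a contradiction.
  by_cases h : k₁₁ + k₂₂ + c = 0
  · have hc : c = 1 / 2 := by linarith
    refine ⟨by rw [hc]; norm_num, .inr ⟨by linarith, ?_, ?_⟩⟩
    · by_contra hg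
      have e1 : k₂₂ - k₁₁ = 0 := by
        have : g * (k₂₂ - k₁₁) = 0 := by linear_combination h2 + k₁₂ * h
        simpa [hg] using this
      have e2 : k₁₂ + k₂₁ = 0 := by
        have : g * (k₁₂ + k₂₁) = 0 := by
          linear_combination (1 / 2) * h1 - (1 / 2) * h4 + (1 / 2) * (k₁₁ - k₂₂) * h
        simpa [hg] using this
      have e3 : k₁₁ = -1 / 4 := by linarith
      have e4 : k₂₁ = -k₁₂ := by linarith
      rw [e2, e3, e4, hc] at h1
      nlinarith [sq_nonneg k₁₂]
    · have e : k₂₂ = -c - k₁₁ := by linarith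
      subst e
      linear_combination (1 / 2) * h1 + (1 / 2) * h4
  -- The commutator side is symmetric, so now `K` is symmetric. Its off-diagonal entry and the
  -- difference of its diagonal entries then satisfy a linear system with only the zero solution,
  -- and `K` is scalar.
  · have e1 : k₁₂ = k₂₁ := by
      have : (k₁₁ + k₂₂ + c) * (k₁₂ - k₂₁) = 0 := by linear_combination h3 - h2
      have := (mul_eq_zero.1 this).resolve_left h
      linarith
    subst e1
    have e2 : 4 * g * k₁₂ = (k₁₁ - k₂₂) * (k₁₁ + k₂₂ + c) := by linear_combination h1 - h4
    have e3 : g * (k₂₂ - k₁₁) = k₁₂ * (k₁₁ + k₂₂ + c) := by linear_combination h2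
    have hne : 0 < (k₁₁ + k₂₂ + c) ^ 2 := by positivity
    have e4 : k₁₂ = 0 := by
      have : k₁₂ * ((k₁₁ + k₂₂ + c) ^ 2 + 4 * g ^ 2) = 0 := by
        linear_combination g * e2 - (k₁₁ + k₂₂ + c) * e3
      exact (mul_eq_zero.1 this).resolve_right (by positivity)
    subst e4
    have e5 : k₁₁ = k₂₂ := by
      have : (k₁₁ - k₂₂) * (k₁₁ + k₂₂ + c) = 0 := by linear_combination -e2
      have := (mul_eq_zero.1 this).resolve_right h
      linarith
    subst e5
    have e6 : k₁₁ * (k₁₁ + c) = 0 := by linear_combination -h1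
    rcases mul_eq_zero.1 e6 with e | e
    · exact ⟨fun hc => by subst hc; linarith, .inl ⟨rfl, rfl, rfl, .inl e⟩⟩
    · exact ⟨fun hc => by subst hc; linarith, .inl ⟨rfl, rfl, rfl, .inr (by linarith)⟩⟩

/-- A four-dimensional nonunimodular Lorentzian flat Lie algebra belongs to one of the families. -/
theorem IsLorentzianFlat.metricIsomorphic (h : IsLorentzianFlat B)
    (hd : Module.finrank ℝ 𝔤 = 4) (hu : ¬ IsUnimodular 𝔤) :
    (∃ μ α β lam : ℝ, μ ≠ 0 ∧ MetricIsomorphic B (G4.metric μ α β lam)) ∨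
      (∃ ε μ α β γ : ℝ, (ε = 0 ∨ ε = 1) ∧ μ ≠ 0 ∧
        MetricIsomorphic B (G4'.metric ε μ α β γ)) := by
  obtain ⟨a, b, p, q, c, f₁, f₂, g, k₁₁, k₁₂, k₂₁, k₂₂, hx, h0, h1, h2, h3, h4, hab, hap, haq,
    hbp, hbq, hpq⟩ := h.exists_frame_lie hd hu
  obtain ⟨hc, ⟨rfl, rfl, rfl, hk⟩ | ⟨htr, rfl, hdet⟩⟩ := flat_equations_cases h0 h1 h2 h3 h4
  -- The two scalar values of `K` are the two values of `ε`.
  · obtain ⟨ε, hε, hk⟩ : ∃ ε : ℝ, (ε = 0 ∨ ε = 1) ∧ k₁₁ = -(ε * c) := by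
      rcases hk with hk | hk
      · exact ⟨0, .inl rfl, by simp [hk]⟩
      · exact ⟨1, .inr rfl, by simp [hk]⟩
    subst hk
    refine .inr ⟨ε, c, -f₁, -f₂, g, hε, hc, metricIsomorphic_G4' hx hd hab hap haq ?_ ?_ ?_⟩
    · rw [hbp]; module
    · rw [hbq]; module
    · rw [hpq]; module
  -- With `(s, t)` in the left kernel of `K` and `g = 0`, the bracket of `b` with `s p + t q` lies
  -- on the line of `a`. The condition `tr K = -c` then gives the coefficient `c` for the other
  -- rotated vector.
  · obtain ⟨s, t, hst, hs1, hs2⟩ := exists_unit_kernel hdet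
    refine .inl ⟨c, -(t * f₁) + s * f₂, -(s * f₁) - t * f₂, k₂₁ - k₁₂, hc,
      metricIsomorphic_G4 (hx.rotate h.symm hst) hd hab ?_ ?_ ?_ ?_ ?_⟩
    · simp [hap, haq]
    · simp [hap, haq]
    · rw [lie_sub, lie_smul, lie_smul, hbp, hbq]
      have e1 : -(t * k₁₁) + s * k₂₁ = c * t + (k₂₁ - k₁₂) * s := by
        linear_combination hs2 - t * htr
      have e2 : -(t * k₁₂) + s * k₂₂ = -(c * s) + (k₂₁ - k₁₂) * t := by
        linear_combination s * htr - hs1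
      linear_combination (norm := module) e1 • p + e2 • q
    · rw [lie_add, lie_smul, lie_smul, hbp, hbq]
      linear_combination (norm := module) (-hs1) • p - hs2 • q
    · simp only [sub_lie, lie_add, smul_lie, lie_smul, lie_self, smul_zero]
      rw [← lie_skew q p, hpq]
      linear_combination (norm := module) (hst * (k₂₁ - k₁₂)) • a

end Classification

end LorentzFlat

end

open LorentzFlat in
theorem mainTheorem2 :
    -- every 4-dimensional nonunimodular Lorentzian flat Lie algebra is in one of the families
    (∀ (𝔤 : Type*) [LieRing 𝔤] [LieAlgebra ℝ 𝔤] [FiniteDimensional ℝ 𝔤]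
        (B : LinearMap.BilinForm ℝ 𝔤),
        Module.finrank ℝ 𝔤 = 4 → IsLorentzianFlat B → ¬ IsUnimodular 𝔤 →
        (∃ μ α β lam : ℝ, μ ≠ 0 ∧ MetricIsomorphic B (G4.metric μ α β lam)) ∨
        (∃ ε μ α β γ : ℝ, (ε = 0 ∨ ε = 1) ∧ μ ≠ 0 ∧
          MetricIsomorphic B (G4'.metric ε μ α β γ))) ∧
    -- every member of the families is a nonunimodular Lorentzian flat Lie algebra
    (∀ μ α β lam : ℝ, μ ≠ 0 →
        IsLorentzianFlat (G4.metric μ α β lam) ∧ ¬ IsUnimodular (G4 μ α β lam)) ∧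
    (∀ ε μ α β γ : ℝ, (ε = 0 ∨ ε = 1) → μ ≠ 0 →
        IsLorentzianFlat (G4'.metric ε μ α β γ) ∧ ¬ IsUnimodular (G4' ε μ α β γ)) ∧
    -- the dimensions of the derived algebras
    (∀ μ α β lam : ℝ, μ ≠ 0 → derivedDim (G4 μ α β lam) = 2) ∧
    (∀ ε μ α β γ : ℝ, (ε = 0 ∨ ε = 1) → μ ≠ 0 →
        derivedDim (G4' ε μ α β γ) = 1 ∨ derivedDim (G4' ε μ α β γ) = 3) ∧
    -- no member of the first family is isomorphic, even as a Lie algebra, to one of the second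
    (∀ μ α β lam ε μ' α' β' γ : ℝ, μ ≠ 0 → (ε = 0 ∨ ε = 1) → μ' ≠ 0 →
        IsEmpty (G4 μ α β lam ≃ₗ⁅ℝ⁆ G4' ε μ' α' β' γ)) := by
  refine ⟨fun 𝔤 _ _ _ B hd h hu => h.metricIsomorphic hd hu,
    fun μ α β lam hμ => ⟨G4.isLorentzianFlat μ α β lam, G4.not_isUnimodular α β lam hμ⟩,
    fun ε μ α β γ hε hμ => ⟨G4'.isLorentzianFlat μ α β γ hε, G4'.not_isUnimodular α β γ hε hμ⟩,
    fun μ α β lam hμ => G4.derivedDim_eq_two α β lam hμ,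
    fun ε μ α β γ hε hμ => G4'.derivedDim_eq α β γ hε hμ,
    fun μ α β lam ε μ' α' β' γ hμ hε hμ' => ⟨fun φ => ?_⟩⟩
  have h1 := derivedDim_congr φ
  have h2 := G4'.derivedDim_eq α' β' γ hε hμ'
  rw [G4.derivedDim_eq_two α β lam hμ] at h1
  omega
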